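/- Let $T=\begin{pmatrix}1&1\\0&1\end{pmatrix}$, $L=\begin{pmatrix}1&0\\1&1\end{pmatrix}$, let $\Gamma_N\subset \mathrm{SL}_2(\mathbb{Z})$ be the principal congruence subgroup of level $N$ and $\mathrm{P}\Gamma_N$ its image in $\mathrm{PSL}_2(\mathbb{Z})$; $\mathrm{P}\Gamma_6$ is normal in $\mathrm{P}\Gamma_2$. An origami is a translation surface obtained by gluing finitely many unit squares along their edges by translations. Let $X$ be the origami whose squares are labelled by the pairs $(A,h)$ with $A\in \mathrm{P}\Gamma_6\backslash \mathrm{P}\Gamma_2$ and $h\in\{1,2,3,4\}$, with horizontal gluings (right edge of a square to the left edge of its image) $$(A,1)\mapsto(A,2),\quad (A,2)\mapsto(AL^{-2},1),\quad (A,3)\mapsto(A,4),\quad (A,4)\mapsto(AL^{2},3)$$ and vertical gluings (upper edge of a square to the lower edge of its image) $$(A,1)\mapsto(AL^{2},3),\quad (A,2)\mapsto(AL^{-2},4),\quad (A,3)\mapsto(AT^{-2},1),\quad (A,4)\mapsto(AT^{2},2).$$ Let $E[2]$ be the origami with four squares $1,2,3,4$, horizontal gluings $(1\,2)(3\,4)$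 and vertical gluings $(1\,3)(2\,4)$, and let $p:X\to E[2]$ map the square $(A,h)$ to the square $h$ by a translation. Let $P,Q,S\in E[2]$ be the lower left corners of the squares $1,2,4$. For $B\in \mathrm{P}\Gamma_2/\mathrm{P}\Gamma_6$ let $\tau_B:X\to X$ map each square $(A,h)$ to the square $(BA,h)$ by a translation. An affine homeomorphism of $X$ with derivative $D\in\mathrm{SL}_2(\mathbb{R})$ is a homeomorphism of $X$ that preserves the set of singularities and is, away from them, locally of the form $v\mapsto Dv+b$ in the charts of the translation structure; the Veech group of $X$ is the group of all derivatives $D$, and $\mathrm{Trans}(X)$ is the group of the affine homeomorphisms with derivative the identity. Proposition. The origami $X$ has the following properties. (i) $X$ is a closed connected surface tiled by $48$ squares. Its genus is $13$, and it has exactly twelve singularities, all of cone angle $6\pi$: four over each of $P$, $Q$ and $S$, namely the lower left corners of the squares $(A,h)$ with $h=1$, $h=2$ and $h=4$, respectively; all other points have cone angle $2\pi$. The group of translations is $$\mathrm{Trans}(X)=\{\tau_B \mid B\in \mathrm{P}\Gamma_2/\mathrm{P}\Gamma_6\}\cong \mathrm{P}\Gamma_2/\mathrm{P}\Gamma_6,$$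 where the isomorphism is $\tau_B\leftrightarrow B$, and $\mathrm{P}\Gamma_2/\mathrm{P}\Gamma_6\cong \mathrm{PSL}_2(\mathbb{Z}/3\mathbb{Z})$. The map $p$ is locally a translation in the charts of the translation structures, and it induces an isomorphism of translation surfaces $X/\mathrm{Trans}(X)\cong E[2]$. In particular $p:X\to E[2]$, which is a covering of degree $12$ outside of $P,Q,S$, is normal (its deck transformations act transitively on each fibre), and its group of deck transformations is $\mathrm{Trans}(X)\cong\mathrm{P}\Gamma_2/\mathrm{P}\Gamma_6$. (ii) The Veech group of $X$ is $\mathrm{SL}_2(\mathbb{Z})\subset \mathrm{SL}_2(\mathbb{R})$. -/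

import Mathlib

open Topology Matrix
open scoped MatrixGroups unitInterval

noncomputable section

/-- A (not necessarily connected) origami: finitely many unit squares, glued along their edges by
translations. The right edge of the square `s` is glued to the left edge of `right s`, and the upper
edge of `s` to the lower edge of `up s`. -/
structure Origami where
  Sq : Type
  finite_sq : Finite Sq
  right : Equiv.Perm Sq
  up : Equiv.Perm Sq

namespace Origami

variable (O : Origami)

/-- The disjoint union of the closed unit squares. A point of a square is given by its two
coordinates in `[0, 1]`. -/
abbrev Squares : Type := Σ _ : O.Sq, (Fin 2 → I)

/-- The edge gluings. -/
inductive Glue : O.Squares → O.Squares → Prop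
  | right (s : O.Sq) (t : I) : Glue ⟨s, ![1, t]⟩ ⟨O.right s, ![0, t]⟩
  | up (s : O.Sq) (t : I) : Glue ⟨s, ![t, 1]⟩ ⟨O.up s, ![t, 0]⟩

/-- The surface obtained by gluing the squares, with the quotient topology (`Quot` is the quotient
by the equivalence relation generated by `Glue`). -/
def Surface : Type := Quot O.Glue

instance : TopologicalSpace O.Surface := inferInstanceAs (TopologicalSpace (Quot O.Glue))

variable {O} in
/-- The point of the surface with coordinates `p` in the square `s`. -/
def pt (s : O.Sq) (p : Fin 2 → I) : O.Surface := Quot.mk O.Glue ⟨s, p⟩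

variable {O} in
/-- The lower left corner of the square `s`. -/
def corner (s : O.Sq) : O.Surface := pt s 0

/-! ### The square tiling: Euler characteristic, genus, cone angles -/

/-- The vertices of the tiling, as points of the surface. -/
def vertices : Set O.Surface :=
  {x | ∃ (s : O.Sq) (p : Fin 2 → I), (∀ i, p i = 0 ∨ p i = 1) ∧ x = pt s p}

/-- The (closed) edges of the tiling, as subsets of the surface. -/
def edges : Set (Set O.Surface) :=
  {e | ∃ (s : O.Sq) (i : Fin 2) (c : I), (c = 0 ∨ c = 1) ∧ e = pt s '' {p | p i = c}}

/-- The (closed) faces of the tiling, as subsets of the surface. -/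
def faces : Set (Set O.Surface) :=
  {F | ∃ s : O.Sq, F = Set.range (pt s)}

/-- The Euler characteristic `V - E + F`. -/
def eulerChar : ℤ := (O.vertices.ncard : ℤ) - O.edges.ncard + O.faces.ncard

/-- The surface is connected, and its genus, determined by `χ = 2 - 2g`, is `g`. -/
def HasGenus (g : ℕ) : Prop := ConnectedSpace O.Surface ∧ O.eulerChar = 2 - 2 * (g : ℤ)

open Classical in
/-- The angle of the unit square at its point `p`: it is `2π` in the interior, `π` on an open edge
and `π / 2` at a corner. -/
def squareAngle (p : Fin 2 → I) : ℝ :=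
  2 * Real.pi * ∏ i, (if p i = 0 ∨ p i = 1 then 1 / 2 else 1)

variable {O} in
/-- The cone angle at `x`: the sum of the angles of the squares at all the points which are glued
to `x`. -/
def coneAngle (x : O.Surface) : ℝ :=
  ∑ᶠ q : {q : O.Squares // pt q.1 q.2 = x}, squareAngle q.1.2

/-! ### The translation structure -/

/-- A point of the unit square as a vector in the plane. -/
def toPlane (p : Fin 2 → I) : Fin 2 → ℝ := fun i => (p i : ℝ)

variable {O} in
/-- The charts of the translation structure: homeomorphisms from an open subset of the surface to
an open subset of the plane which on each of the squares are locally translations. -/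
def IsTranslationChart (e : OpenPartialHomeomorph O.Surface (Fin 2 → ℝ)) : Prop :=
  ∀ (s : O.Sq) (p : Fin 2 → I), pt s p ∈ e.source →
    ∀ᶠ q in 𝓝 p, e (pt s q) = e (pt s p) + (toPlane q - toPlane p)

/-- The singularities: the points which lie in the domain of no translation chart. -/
def singularities : Set O.Surface :=
  {x | ∀ e : OpenPartialHomeomorph O.Surface (Fin 2 → ℝ), IsTranslationChart e → x ∉ e.source}

variable {O} in
/-- `f` is an affine homeomorphism with derivative `A`: it preserves the set of singularities, and
away from them it has in translation charts locally the form `v ↦ A v + b`. -/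
def IsAffine (f : O.Surface ≃ₜ O.Surface) (A : SL(2, ℝ)) : Prop :=
  (∀ x, f x ∈ O.singularities ↔ x ∈ O.singularities) ∧
  ∀ e e' : OpenPartialHomeomorph O.Surface (Fin 2 → ℝ),
    IsTranslationChart e → IsTranslationChart e' → ∀ x ∈ e.source, f x ∈ e'.source →
      ∀ᶠ y in 𝓝 x, e' (f y) = e' (f x) + A.1 *ᵥ (e y - e x)

variable {O} in
theorem IsTranslationChart.eventually_eq {e e' : OpenPartialHomeomorph O.Surface (Fin 2 → ℝ)}
    (he : IsTranslationChart e) (he' : IsTranslationChart e') {x : O.Surface}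
    (hx : x ∈ e.source) (hx' : x ∈ e'.source) :
    ∀ᶠ y in 𝓝 x, e' y = e' x + (e y - e x) := by
  have hq : IsQuotientMap (fun q : O.Squares => (pt q.1 q.2 : O.Surface)) :=
    isQuotientMap_quot_mk
  -- the set of points at which `e' - e` is locally constant near `x`
  let W : Set O.Surface := {y | e' y - e y = e' x - e x}
  have hW : ∀ y ∈ (e.source ∩ e'.source) ∩ W, ∀ (s : O.Sq) (p : Fin 2 → I), pt s p = y →
      ∀ᶠ q in 𝓝 p, pt s q ∈ (e.source ∩ e'.source) ∩ W := by
    rintro y ⟨⟨h1, h2⟩, h3⟩ s p rfl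
    have hc : Continuous fun q : Fin 2 → I => (pt s q : O.Surface) :=
      hq.continuous.comp (continuous_sigmaMk)
    filter_upwards [he s p h1, he' s p h2, hc.continuousAt (e.open_source.mem_nhds h1),
      hc.continuousAt (e'.open_source.mem_nhds h2)] with q k1 k2 k3 k4
    refine ⟨⟨k3, k4⟩, ?_⟩
    change e' (pt s q) - e (pt s q) = e' x - e x
    change e' (pt s p) - e (pt s p) = e' x - e x at h3
    rw [k1, k2, ← h3]; abel
  have hopen : IsOpen ((e.source ∩ e'.source) ∩ W) := by
    rw [← hq.isOpen_preimage, isOpen_sigma_iff]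
    intro s
    rw [isOpen_iff_mem_nhds]
    intro p hp
    exact hW _ hp s p rfl
  filter_upwards [hopen.mem_nhds ⟨⟨hx, hx'⟩, rfl⟩] with y hy
  have : e' y - e y = e' x - e x := hy.2
  rw [sub_eq_iff_eq_add] at this
  rw [this]; abel

variable {O} in
theorem IsAffine.one : IsAffine (1 : O.Surface ≃ₜ O.Surface) 1 := by
  refine ⟨fun x => Iff.rfl, fun e e' he he' x hx hx' => ?_⟩
  filter_upwards [he.eventually_eq he' hx hx'] with y hy
  simpa using hy

variable {O} in
theorem IsAffine.mul {f g : O.Surface ≃ₜ O.Surface} {A B : SL(2, ℝ)} (hf : IsAffine f A)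
    (hg : IsAffine g B) : IsAffine (f * g) (A * B) := by
  refine ⟨fun x => (hf.1 (g x)).trans (hg.1 x), fun e e' he he' x hx hx' => ?_⟩
  have hreg : g x ∉ O.singularities := fun h => (hg.1 x).1 h e he hx
  simp only [singularities, Set.mem_ofPred_eq, not_forall, not_not] at hreg
  obtain ⟨e₁, he₁, hx₁⟩ := hreg
  have h1 := hg.2 e e₁ he he₁ x hx hx₁
  have h2 := g.continuous.continuousAt (hf.2 e₁ e' he₁ he' (g x) hx₁ hx')
  filter_upwards [h1, h2] with y k1 k2
  have k3 : e' (f (g y)) = e' (f (g x)) + A.1 *ᵥ (e₁ (g y) - e₁ (g x)) := k2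
  change e' (f (g y)) = e' (f (g x)) + (A * B).1 *ᵥ (e y - e x)
  rw [k3, k1, add_sub_cancel_left, Matrix.mulVec_mulVec]
  rfl

variable {O} in
theorem IsAffine.inv {f : O.Surface ≃ₜ O.Surface} {A : SL(2, ℝ)} (hf : IsAffine f A) :
    IsAffine f⁻¹ A⁻¹ := by
  have hinv : ∀ z, f (f⁻¹ z) = z := fun z => f.apply_symm_apply z
  refine ⟨fun x => ?_, fun e e' he he' x hx hx' => ?_⟩
  · rw [← hf.1, hinv]
  have h1 := hf.2 e' e he' he (f⁻¹ x) hx' (by rwa [hinv])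
  have h2 := f.symm.continuous.continuousAt h1
  filter_upwards [h2] with y k
  have k' : e (f (f⁻¹ y)) = e (f (f⁻¹ x)) + A.1 *ᵥ (e' (f⁻¹ y) - e' (f⁻¹ x)) := k
  rw [hinv, hinv] at k'
  have hA : A⁻¹.1 * A.1 = 1 := congrArg Subtype.val (inv_mul_cancel A)
  rw [k', add_sub_cancel_left, Matrix.mulVec_mulVec, hA, Matrix.one_mulVec]
  abel

/-- The group of affine homeomorphisms. -/
def affineGroup : Subgroup (O.Surface ≃ₜ O.Surface) where
  carrier := {f | ∃ A, IsAffine f A}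
  one_mem' := ⟨1, IsAffine.one⟩
  mul_mem' := fun ⟨A, hA⟩ ⟨B, hB⟩ => ⟨A * B, hA.mul hB⟩
  inv_mem' := fun ⟨A, hA⟩ => ⟨A⁻¹, hA.inv⟩

/-- The Veech group: the derivatives of the affine homeomorphisms. -/
def veechGroup : Subgroup SL(2, ℝ) where
  carrier := {A | ∃ f ∈ O.affineGroup, IsAffine f A}
  one_mem' := ⟨1, O.affineGroup.one_mem, IsAffine.one⟩
  mul_mem' := fun ⟨f, hf, hA⟩ ⟨g, hg, hB⟩ => ⟨f * g, O.affineGroup.mul_mem hf hg, hA.mul hB⟩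
  inv_mem' := fun ⟨f, hf, hA⟩ => ⟨f⁻¹, O.affineGroup.inv_mem hf, hA.inv⟩

/-- The group of translations: the affine homeomorphisms with derivative the identity. -/
def translationGroup : Subgroup (O.Surface ≃ₜ O.Surface) where
  carrier := {f | IsAffine f 1}
  one_mem' := IsAffine.one
  mul_mem' := fun hf hg => by simpa using IsAffine.mul hf hg
  inv_mem' := fun hf => by simpa using IsAffine.inv hf

/-- Two points are equivalent if a translation maps one to the other. -/
def translationSetoid : Setoid O.Surface where
  r x y := ∃ f ∈ O.translationGroup, f x = y
  iseqv :=
    { refl := fun _ => ⟨1, O.translationGroup.one_mem, rfl⟩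
      symm := by
        rintro x y ⟨f, hf, rfl⟩
        exact ⟨f⁻¹, O.translationGroup.inv_mem hf, f.symm_apply_apply x⟩
      trans := by
        rintro x y z ⟨f, hf, rfl⟩ ⟨g, hg, rfl⟩
        exact ⟨g * f, O.translationGroup.mul_mem hg hf, rfl⟩ }

/-- The quotient of the surface by its group of translations, with the quotient topology. -/
abbrev ModTranslations : Type := Quotient O.translationSetoid

/-! ### Maps between origamis -/

/-- A map which in translation charts is locally a translation. -/
def IsLocalTranslation {O O' : Origami} (f : O.Surface → O'.Surface) : Prop :=
  ∀ (e : OpenPartialHomeomorph O.Surface (Fin 2 → ℝ))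
    (e' : OpenPartialHomeomorph O'.Surface (Fin 2 → ℝ)),
    IsTranslationChart e → IsTranslationChart e' → ∀ x ∈ e.source, f x ∈ e'.source →
      ∀ᶠ y in 𝓝 x, e' (f y) = e' (f x) + (e y - e x)

/-- A map between the sets of squares which respects the gluing rules. -/
structure Hom (O O' : Origami) where
  toFun : O.Sq → O'.Sq
  map_right : ∀ s, toFun (O.right s) = O'.right (toFun s)
  map_up : ∀ s, toFun (O.up s) = O'.up (toFun s)

/-- The induced map between the surfaces, which maps each square `s` to the square `φ s` by the
identity in the coordinates of the squares. -/
def Hom.map {O O' : Origami} (φ : Hom O O') : O.Surface → O'.Surface :=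
  Quot.map (fun q => ⟨φ.toFun q.1, q.2⟩) (by
    intro a b h
    cases h with
    | right s t => exact φ.map_right s ▸ Glue.right _ _
    | up s t => exact φ.map_up s ▸ Glue.up _ _)

end Origami

/-- The group of deck transformations of a map `p`. -/
def deckGroup {S S' : Type} [TopologicalSpace S] (p : S → S') : Subgroup (S ≃ₜ S) where
  carrier := {f | ∀ x, p (f x) = p x}
  one_mem' := fun _ => rfl
  mul_mem' := fun {f g} hf hg x => (hf (g x)).trans (hg x)
  inv_mem' := by
    intro f hf x
    exact (hf (f.symm x)).symm.trans (congrArg p (f.apply_symm_apply x))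

/-! ### The group `PΓ₂ / PΓ₆` -/

/-- The image in `PSL(2, ℤ)` of the principal congruence subgroup of level `N`. -/
def PGamma (N : ℕ) : Subgroup PSL(2, ℤ) :=
  (CongruenceSubgroup.Gamma N).map (QuotientGroup.mk' (Subgroup.center SL(2, ℤ)))

instance (N : ℕ) : (PGamma N).Normal :=
  Subgroup.Normal.map (CongruenceSubgroup.Gamma_normal N) _ (QuotientGroup.mk'_surjective _)

/-- The group `PΓ₂ / PΓ₆`. -/
abbrev PGammaQuot : Type := PGamma 2 ⧸ (PGamma 6).subgroupOf (PGamma 2)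

instance : Finite PGammaQuot := by
  have h : (PGamma 6).FiniteIndex :=
    ⟨fun h0 => by
      have h1 := Subgroup.index_map_dvd (CongruenceSubgroup.Gamma 6)
        (QuotientGroup.mk'_surjective (Subgroup.center SL(2, ℤ)))
      have h2 : ((CongruenceSubgroup.Gamma 6).map
        (QuotientGroup.mk' (Subgroup.center SL(2, ℤ)))).index = 0 := h0
      rw [h2, zero_dvd_iff] at h1
      exact Subgroup.FiniteIndex.index_ne_zero h1⟩
  exact Subgroup.finite_quotient_of_finiteIndex

/-- The matrix `T = (1 1; 0 1)`. -/
def matT : SL(2, ℤ) := ⟨!![1, 1; 0, 1], by simp⟩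

/-- The matrix `L = (1 0; 1 1)`. -/
def matL : SL(2, ℤ) := ⟨!![1, 0; 1, 1], by simp⟩

theorem matT_sq_mem : matT ^ 2 ∈ CongruenceSubgroup.Gamma 2 := by
  have h : (matT ^ 2).1 = !![1, 2; 0, 1] := by
    rw [pow_two]
    change !![(1 : ℤ), 1; 0, 1] * !![1, 1; 0, 1] = _
    decide
  rw [CongruenceSubgroup.Gamma_mem]
  change (((matT ^ 2).1 0 0 : ℤ) : ZMod 2) = 1 ∧ (((matT ^ 2).1 0 1 : ℤ) : ZMod 2) = 0 ∧
    (((matT ^ 2).1 1 0 : ℤ) : ZMod 2) = 0 ∧ (((matT ^ 2).1 1 1 : ℤ) : ZMod 2) = 1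
  rw [h]
  decide

theorem matL_sq_mem : matL ^ 2 ∈ CongruenceSubgroup.Gamma 2 := by
  have h : (matL ^ 2).1 = !![1, 0; 2, 1] := by
    rw [pow_two]
    change !![(1 : ℤ), 0; 1, 1] * !![1, 0; 1, 1] = _
    decide
  rw [CongruenceSubgroup.Gamma_mem]
  change (((matL ^ 2).1 0 0 : ℤ) : ZMod 2) = 1 ∧ (((matL ^ 2).1 0 1 : ℤ) : ZMod 2) = 0 ∧
    (((matL ^ 2).1 1 0 : ℤ) : ZMod 2) = 0 ∧ (((matL ^ 2).1 1 1 : ℤ) : ZMod 2) = 1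
  rw [h]
  decide

/-- The class in `PΓ₂ / PΓ₆` of an element of `Γ₂`. -/
def toQuot (g : SL(2, ℤ)) (hg : g ∈ CongruenceSubgroup.Gamma 2) : PGammaQuot :=
  QuotientGroup.mk (⟨QuotientGroup.mk g, Subgroup.mem_map_of_mem _ hg⟩ : PGamma 2)

/-- The class of `T²`. -/
def clT2 : PGammaQuot := toQuot (matT ^ 2) matT_sq_mem

/-- The class of `L²`. -/
def clL2 : PGammaQuot := toQuot (matL ^ 2) matL_sq_mem

/-! ### The origamis `X` and `E[2]` -/

/-- The horizontal gluings of `X`. The squares are labelled by pairs `(A, h)`; the labels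
`h = 1, 2, 3, 4` are written as `0, 1, 2, 3`, and the right cosets of the normal subgroup `PΓ₆` of
`PΓ₂` are elements of the quotient group. -/
def rightX : Equiv.Perm (PGammaQuot × Fin 4) where
  toFun
    | (A, 0) => (A, 1)
    | (A, 1) => (A * clL2⁻¹, 0)
    | (A, 2) => (A, 3)
    | (A, 3) => (A * clL2, 2)
  invFun
    | (A, 0) => (A * clL2, 1)
    | (A, 1) => (A, 0)
    | (A, 2) => (A * clL2⁻¹, 3)
    | (A, 3) => (A, 2)
  left_inv := by
    rintro ⟨A, h⟩
    fin_cases h <;> simp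
  right_inv := by
    rintro ⟨A, h⟩
    fin_cases h <;> simp

/-- The vertical gluings of `X`. -/
def upX : Equiv.Perm (PGammaQuot × Fin 4) where
  toFun
    | (A, 0) => (A * clL2, 2)
    | (A, 1) => (A * clL2⁻¹, 3)
    | (A, 2) => (A * clT2⁻¹, 0)
    | (A, 3) => (A * clT2, 1)
  invFun
    | (A, 0) => (A * clT2, 2)
    | (A, 1) => (A * clT2⁻¹, 3)
    | (A, 2) => (A * clL2⁻¹, 0)
    | (A, 3) => (A * clL2, 1)
  left_inv := by
    rintro ⟨A, h⟩
    fin_cases h <;> simp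
  right_inv := by
    rintro ⟨A, h⟩
    fin_cases h <;> simp

/-- The origami `X`. -/
def origamiX : Origami where
  Sq := PGammaQuot × Fin 4
  finite_sq := inferInstance
  right := rightX
  up := upX

/-- The horizontal gluings `(1 2)(3 4)` of `E[2]`. -/
def rightE2 : Equiv.Perm (Fin 4) := Equiv.swap 0 1 * Equiv.swap 2 3

/-- The vertical gluings `(1 3)(2 4)` of `E[2]`. -/
def upE2 : Equiv.Perm (Fin 4) := Equiv.swap 0 2 * Equiv.swap 1 3

/-- The trivial `2 × 2` origami `E[2]`, with the squares `1, 2` in the lower row and `3, 4` in the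
upper row written as `0, 1, 2, 3`, and opposite edges glued. -/
def origamiE2 : Origami where
  Sq := Fin 4
  finite_sq := inferInstance
  right := rightE2
  up := upE2

/-- The covering `p : X → E[2]`, which maps the square `(A, h)` to the square `h`. -/
def coveringP : Origami.Hom origamiX origamiE2 where
  toFun := fun s => s.2
  map_right := by
    rintro ⟨A, h⟩
    match h with
    | 0 => exact (by decide : (1 : Fin 4) = rightE2 0)
    | 1 => exact (by decide : (0 : Fin 4) = rightE2 1)
    | 2 => exact (by decide : (3 : Fin 4) = rightE2 2)
    | 3 => exact (by decide : (2 : Fin 4) = rightE2 3)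
  map_up := by
    rintro ⟨A, h⟩
    match h with
    | 0 => exact (by decide : (2 : Fin 4) = upE2 0)
    | 1 => exact (by decide : (3 : Fin 4) = upE2 1)
    | 2 => exact (by decide : (0 : Fin 4) = upE2 2)
    | 3 => exact (by decide : (1 : Fin 4) = upE2 3)

/-- The map `τ_B : X → X`, which maps the square `(A, h)` to the square `(B A, h)`. -/
def tau (B : PGammaQuot) : Origami.Hom origamiX origamiX where
  toFun := fun s => (B * s.1, s.2)
  map_right := by
    rintro ⟨A, h⟩
    match h with
    | 0 => rfl
    | 1 => exact congrArg (·, (0 : Fin 4)) (mul_assoc B A clL2⁻¹).symm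
    | 2 => rfl
    | 3 => exact congrArg (·, (2 : Fin 4)) (mul_assoc B A clL2).symm
  map_up := by
    rintro ⟨A, h⟩
    match h with
    | 0 => exact congrArg (·, (2 : Fin 4)) (mul_assoc B A clL2).symm
    | 1 => exact congrArg (·, (3 : Fin 4)) (mul_assoc B A clL2⁻¹).symm
    | 2 => exact congrArg (·, (0 : Fin 4)) (mul_assoc B A clT2⁻¹).symm
    | 3 => exact congrArg (·, (1 : Fin 4)) (mul_assoc B A clT2).symm

/-- The lower left corners `P`, `Q`, `S` of the squares `1`, `2`, `4` of `E[2]`. -/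
def pointsPQS : Set origamiE2.Surface :=
  (fun h : Fin 4 => Origami.corner (O := origamiE2) h) '' {0, 1, 3}

/-- The lower left corners of the squares `(A, h)`, for all `A` and a fixed `h`. -/
def cornersX (h : Fin 4) : Set origamiX.Surface :=
  Set.range fun A : PGammaQuot => Origami.corner (O := origamiX) (A, h)

end

noncomputable section

namespace Origami

variable {O O' : Origami}

/-! The local geometry of an origami is governed by the commutator `comm` of the two gluing
permutations. Every point has a representative with both coordinates in [0,1), and this normal form
is unique except that the lower left corners of the squares in one cycle of `comm` coincide
(`pt_eq_iff`). So vertices are cycles of `comm`, a cycle of length k gives cone angle 2πk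
(`coneAngle_corner`), and a point has a translation chart exactly when it is not the corner of a
square moved by `comm` (`mem_singularities_iff_exists`).

For X, write t and l for the classes of T² and L². Reduction modulo 3 identifies the quotient group
with PSL₂(ℤ/3), of order 12, where t³ = l³ = (tl)² = 1 (`quotEquiv`, `clT2_mul_clL2_sq`). On the
squares with label h, `comm` is right multiplication by `cornerGen h` (`comm_origamiX`), of order 3
except for the third label, where it is trivial. This gives 4 + 4 + 4 singular vertices of angle 6π
and 12 regular ones, so χ = 24 - 96 + 48 = -24 and the genus is 13.

Global rigidity comes from the projection `toTorus` to ℝ²/ℤ², which sends all singularities to 0. On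
each closed square an affine homeomorphism, followed by `toTorus`, is affine with the same linear
part (`IsAffine.toTorus_eq`). Every square of X has a singular corner, so a translation commutes
with `toTorus`. A continuous map commuting with `toTorus` is a map of squares compatible with the
gluings (`exists_hom_of_toTorus_eq`), and by connectedness such a map is determined by the image of
one square. Since translations preserve the one label whose lower left corners are regular, they are
the maps τ_B. Deck transformations of p also commute with `toTorus`, hence are the same maps, and
fibres of p are orbits of the τ_B.

For the Veech group, three singular corners of one square are sent over 0, which makes both columns
of the derivative integral (`veechGroup_le_range`). Conversely, the quarter turn and the horizontal
shear generate SL₂(ℤ), and each is realised by a permutation of the squares with suitable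
commutation relations; these reduce to t³ = l³ = (tl)² = 1 (`range_le_veechGroup`). Affinity of
explicit maps is checked square by square through `IsStepAffine`, without reference to charts. -/

instance : Finite O.Sq := O.finite_sq

/-! ### Coincidences of points of the squares -/

variable (O) in
/-- Going once around the lower left corner of a square. -/
def comm : Equiv.Perm O.Sq := O.right * O.up * O.right⁻¹ * O.up⁻¹

theorem comm_up_right (s : O.Sq) : O.comm (O.up (O.right s)) = O.right (O.up s) := by
  simp [comm]

theorem pt_right (s : O.Sq) (t : I) : pt s ![1, t] = pt (O.right s) ![0, t] :=
  Quot.sound (Glue.right s t)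

theorem pt_up (s : O.Sq) (t : I) : pt s ![t, 1] = pt (O.up s) ![t, 0] :=
  Quot.sound (Glue.up s t)

theorem vec_eta {α : Type*} (p : Fin 2 → α) : p = ![p 0, p 1] := by
  ext i; fin_cases i <;> rfl

theorem zero_eq_vec : (0 : Fin 2 → I) = ![0, 0] := vec_eta _

open Classical in
/-- The coordinate `1` is replaced by `0`. -/
def low (t : I) : I := if t = 1 then 0 else t

@[simp] theorem low_one : low 1 = 0 := by simp [low]

@[simp] theorem low_zero : low 0 = 0 := by simp [low]

theorem low_of_ne {t : I} (h : t ≠ 1) : low t = t := by simp [low, h]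

theorem low_ne_one (t : I) : low t ≠ 1 := by
  unfold low; split_ifs with h
  · exact zero_ne_one
  · exact h

open Classical in
/-- The square which contains the point with coordinates `p` of `s` with both coordinates
different from `1`. -/
def lowSq (s : O.Sq) (p : Fin 2 → I) : O.Sq :=
  (if p 1 = 1 then O.up else 1) ((if p 0 = 1 then O.right else 1) s)

/-- The coordinates of the point `p` of a square in the square `lowSq s p`. -/
def lowPt (p : Fin 2 → I) : Fin 2 → I := fun i => low (p i)

theorem lowPt_of_ne {p : Fin 2 → I} (h : ∀ i, p i ≠ 1) : lowPt p = p := by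
  ext i; simp [lowPt, low_of_ne (h i)]

theorem lowSq_of_ne {s : O.Sq} {p : Fin 2 → I} (h : ∀ i, p i ≠ 1) : lowSq s p = s := by
  simp [lowSq, h 0, h 1]

theorem lowPt_ne_one (p : Fin 2 → I) (i : Fin 2) : lowPt p i ≠ 1 := low_ne_one _

theorem pt_low (s : O.Sq) (p : Fin 2 → I) : pt (lowSq s p) (lowPt p) = pt s p := by
  rw [vec_eta (lowPt p)]
  conv_rhs => rw [vec_eta p]
  by_cases h0 : p 0 = 1 <;> by_cases h1 : p 1 = 1
  · rw [h0, h1, pt_right, pt_up]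
    simp [lowSq, lowPt, h0, h1]
  all_goals simp [lowSq, lowPt, h0, h1, low_of_ne, pt_up, pt_right]

theorem corner_comm (s : O.Sq) : corner (O.comm s) = corner s := by
  obtain ⟨s, rfl⟩ := O.up.surjective s
  obtain ⟨s, rfl⟩ := O.right.surjective s
  rw [comm_up_right, corner, corner, zero_eq_vec, ← pt_right, ← pt_up, ← pt_up, ← pt_right]

theorem corner_eq_of_sameCycle {s s' : O.Sq} (h : O.comm.SameCycle s s') :
    corner s = corner s' := by
  obtain ⟨i, -, rfl⟩ := h.exists_pow_eq'
  induction i with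
  | zero => rfl
  | succ n ih => rw [pow_succ', Equiv.Perm.mul_apply, corner_comm, ← ih ⟨n, rfl⟩]

/-- Passing to normal form is compatible with both kinds of gluing except at the upper right corner
of a square, where right-then-up and up-then-right lead to squares that differ by one application of
`comm`. -/
theorem pt_eq_iff {s s' : O.Sq} {p p' : Fin 2 → I} : pt s p = pt s' p' ↔
    lowPt p = lowPt p' ∧ (lowSq s p = lowSq s' p' ∨
      lowPt p = 0 ∧ O.comm.SameCycle (lowSq s p) (lowSq s' p')) := by
  constructor
  · intro h
    have h : Relation.EqvGen O.Glue ⟨s, p⟩ ⟨s', p'⟩ := Quot.eqvGen_exact h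
    suffices ∀ q q' : O.Squares, Relation.EqvGen O.Glue q q' → lowPt q.2 = lowPt q'.2 ∧
        (lowSq q.1 q.2 = lowSq q'.1 q'.2 ∨
          lowPt q.2 = 0 ∧ O.comm.SameCycle (lowSq q.1 q.2) (lowSq q'.1 q'.2)) from
      this _ _ h
    intro q q' h
    induction h with
    | rel q q' h =>
      cases h with
      | right s t =>
        refine ⟨?_, .inl (by simp [lowSq])⟩
        ext i; fin_cases i <;> simp [lowPt]
      | up s t =>
        refine ⟨by ext i; fin_cases i <;> simp [lowPt], ?_⟩
        -- At t = 1 the two sides have the normal squares `O.up (O.right s)` and `O.right (O.up s)`.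
        by_cases ht : t = 1
        · subst ht
          refine .inr ⟨by ext i; fin_cases i <;> simp [lowPt], ?_⟩
          simp only [lowSq, cons_val_one, cons_val_zero, if_true, zero_ne_one,
            if_false, Equiv.Perm.one_apply]
          exact ⟨1, by rw [zpow_one, comm_up_right]⟩
        · exact .inl (by simp [lowSq, ht])
    | refl q => exact ⟨rfl, .inl rfl⟩
    | symm q q' _ ih => exact ⟨ih.1.symm, ih.2.imp Eq.symm fun h => ⟨ih.1 ▸ h.1, h.2.symm⟩⟩
    | trans q q' q'' _ _ ih ih' =>
      refine ⟨ih.1.trans ih'.1, ?_⟩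
      rcases ih.2 with h | ⟨h0, h⟩ <;> rcases ih'.2 with h' | ⟨h0', h'⟩
      · exact .inl (h.trans h')
      · exact .inr ⟨ih.1 ▸ h0', h ▸ h'⟩
      · exact .inr ⟨h0, h' ▸ h⟩
      · exact .inr ⟨h0, h.trans h'⟩
  · rintro ⟨h, h'⟩
    rw [← pt_low s, ← pt_low s', ← h]
    rcases h' with h' | ⟨h0, h'⟩
    · rw [h']
    · rw [h0]; exact corner_eq_of_sameCycle h'

theorem pt_eq_iff_of_ne {s s' : O.Sq} {p p' : Fin 2 → I} (hp : ∀ i, p i ≠ 1)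
    (hp' : ∀ i, p' i ≠ 1) : pt s p = pt s' p' ↔
    p = p' ∧ (s = s' ∨ p = 0 ∧ O.comm.SameCycle s s') := by
  rw [pt_eq_iff, lowPt_of_ne hp, lowPt_of_ne hp', lowSq_of_ne hp, lowSq_of_ne hp']

theorem corner_eq_iff {s s' : O.Sq} : corner s = corner s' ↔ O.comm.SameCycle s s' := by
  rw [corner, corner, pt_eq_iff_of_ne (by simp) (by simp)]
  exact ⟨fun h => h.2.elim (fun h => h ▸ .rfl) And.right, fun h => ⟨rfl, .inr ⟨rfl, h⟩⟩⟩

theorem exists_eq_pt (x : O.Surface) : ∃ s p, (∀ i, p i ≠ 1) ∧ x = pt s p := by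
  induction x using Quot.ind with
  | mk q => exact ⟨_, _, lowPt_ne_one q.2, (pt_low q.1 q.2).symm⟩

theorem pt_surjective : Function.Surjective fun q : O.Squares => (pt q.1 q.2 : O.Surface) :=
  Quot.mk_surjective

/-! ### Topology of the surface -/

theorem isQuotientMap_pt : IsQuotientMap fun q : O.Squares => (pt q.1 q.2 : O.Surface) :=
  isQuotientMap_quot_mk

theorem continuous_pt (s : O.Sq) : Continuous (pt s : (Fin 2 → I) → O.Surface) :=
  isQuotientMap_pt.continuous.comp continuous_sigmaMk

instance : CompactSpace O.Surface := inferInstanceAs (CompactSpace (Quot O.Glue))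

theorem continuous_of_forall_pt {Y : Type*} [TopologicalSpace Y] {f : O.Surface → Y}
    (h : ∀ s, Continuous fun p => f (pt s p)) : Continuous f := by
  rw [isQuotientMap_pt.continuous_iff, continuous_sigma_iff]
  exact h

/-- A function on the surface given by a function on each square which is compatible with the
gluings. -/
def lift {Y : Type*} (f : O.Sq → I → I → Y)
    (hr : ∀ s t, f s 1 t = f (O.right s) 0 t) (hu : ∀ s t, f s t 1 = f (O.up s) t 0) :
    O.Surface → Y :=
  Quot.lift (fun q => f q.1 (q.2 0) (q.2 1)) (by
    intro a b h
    cases h with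
    | right s t => exact hr s t
    | up s t => exact hu s t)

@[simp] theorem lift_pt {Y : Type*} (f : O.Sq → I → I → Y) (hr hu) (s : O.Sq) (p : Fin 2 → I) :
    lift f hr hu (pt s p) = f s (p 0) (p 1) := rfl

/-! ### Separating functions and the Hausdorff property -/

open Classical in
/-- A function which is positive on the interior of the square `s` and zero elsewhere. -/
def sepFace (s : O.Sq) : O.Surface → ℝ :=
  lift (fun s' a b => (if s' = s then 1 else 0) * ((a : ℝ) * (1 - a) * (b * (1 - b))))
    (by simp) (by simp)

open Classical in
/-- A function which is positive on the left edge of the square `s` and zero on all other vertical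
edges. -/
def sepVert (s : O.Sq) : O.Surface → ℝ :=
  lift (fun s' a b => ((if s' = s then 1 else 0) * (1 - (a : ℝ)) +
    (if O.right s' = s then 1 else 0) * a) * ((b : ℝ) * (1 - b)))
    (by simp) (by simp)

open Classical in
/-- A function which is positive on the lower edge of the square `s` and zero on all other
horizontal edges. -/
def sepHor (s : O.Sq) : O.Surface → ℝ :=
  lift (fun s' a b => ((if s' = s then 1 else 0) * (1 - (b : ℝ)) +
    (if O.up s' = s then 1 else 0) * b) * ((a : ℝ) * (1 - a)))
    (by simp) (by simp)

open Classical in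
/-- A function which is `1` at the lower left corner of the square `s` and zero at all other
vertices. -/
def sepCorner (s : O.Sq) : O.Surface → ℝ :=
  let w : O.Sq → ℝ := fun s' => if O.comm.SameCycle s s' then 1 else 0
  have hw : ∀ s', w (O.right (O.up s')) = w (O.up (O.right s')) := fun s' => by
    simp only [w, ← comm_up_right, Equiv.Perm.sameCycle_apply_right]
  lift (fun s' a b => w s' * ((1 - (a : ℝ)) * (1 - b)) + w (O.right s') * (a * (1 - b)) +
    w (O.up s') * ((1 - a) * b) + w (O.up (O.right s')) * (a * b))
    (by intro s t; simp) (by intro s t; simp [hw])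

theorem continuous_sepFace (s : O.Sq) : Continuous (sepFace s) :=
  continuous_of_forall_pt fun s' => by simp only [sepFace, lift_pt]; fun_prop

theorem continuous_sepVert (s : O.Sq) : Continuous (sepVert s) :=
  continuous_of_forall_pt fun s' => by simp only [sepVert, lift_pt]; fun_prop

theorem continuous_sepHor (s : O.Sq) : Continuous (sepHor s) :=
  continuous_of_forall_pt fun s' => by simp only [sepHor, lift_pt]; fun_prop

theorem continuous_sepCorner (s : O.Sq) : Continuous (sepCorner s) :=
  continuous_of_forall_pt fun s' => by simp only [sepCorner, lift_pt]; fun_prop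

/-! ### The projection to the torus -/

/-- The projection of the surface to the torus `ℝ² / ℤ²`. -/
def toTorus : O.Surface → Fin 2 → UnitAddCircle :=
  lift (fun _ a b => ![((a : ℝ) : UnitAddCircle), ((b : ℝ) : UnitAddCircle)])
    (by simp) (by simp)

theorem toTorus_pt (s : O.Sq) (p : Fin 2 → I) :
    toTorus (pt s p) = fun i => ((toPlane p i : ℝ) : UnitAddCircle) := by
  ext i; fin_cases i <;> rfl

theorem continuous_toTorus : Continuous (toTorus : O.Surface → _) :=
  continuous_of_forall_pt fun s => by
    simp only [toTorus_pt, toPlane]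
    exact continuous_pi fun i => (AddCircle.continuous_mk' 1).comp (by fun_prop)

theorem coe_eq_coe_iff_low {t t' : I} :
    ((t : ℝ) : UnitAddCircle) = ((t' : ℝ) : UnitAddCircle) ↔ low t = low t' := by
  have key : ∀ t : I, ((t : ℝ) : UnitAddCircle) = ((low t : ℝ) : UnitAddCircle) := fun t => by
    by_cases h : t = 1
    · simp [h]
    · rw [low_of_ne h]
  have hmem : ∀ t : I, (low t : ℝ) ∈ Set.Ico (0 : ℝ) (0 + 1) := fun t =>
    ⟨(low t).2.1, by
      rw [zero_add]
      exact lt_of_le_of_ne (low t).2.2 fun h => low_ne_one t (Subtype.ext h)⟩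
  rw [key t, key t', AddCircle.coe_eq_coe_iff_of_mem_Ico (hmem t) (hmem t'), Subtype.coe_inj]

theorem toTorus_pt_eq_iff {s : O.Sq} {s' : O'.Sq} {p p' : Fin 2 → I} :
    toTorus (pt s p) = toTorus (pt s' p') ↔ lowPt p = lowPt p' := by
  simp only [toTorus_pt, funext_iff, lowPt, toPlane, coe_eq_coe_iff_low]

/-- The torus projection determines the coordinates in [0,1)². What remains is the square, and one
of the four functions detects it according to whether the point is a corner, on an open left or
lower edge, or interior. -/
theorem injective_separate : Function.Injective fun x : O.Surface =>
    (toTorus x, fun s => (sepFace s x, sepVert s x, sepHor s x, sepCorner s x)) := by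
  intro x x' h
  obtain ⟨s, p, hp, rfl⟩ := exists_eq_pt x
  obtain ⟨s', p', hp', rfl⟩ := exists_eq_pt x'
  simp only [Prod.mk.injEq, toTorus_pt_eq_iff, lowPt_of_ne hp, lowPt_of_ne hp'] at h
  obtain ⟨rfl, h⟩ := h
  have h := congrFun h s
  simp only [Prod.mk.injEq, sepFace, sepVert, sepHor, sepCorner, lift_pt] at h
  obtain ⟨h1, h2, h3, h4⟩ := h
  have hne : ∀ i, 1 - (p i : ℝ) ≠ 0 := fun i hi => hp i (Subtype.ext (by rw [Set.Icc.coe_one]; linarith))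
  rw [pt_eq_iff_of_ne hp hp]
  refine ⟨rfl, ?_⟩
  by_cases h0 : p 0 = 0 <;> by_cases h0' : p 1 = 0
  · right
    refine ⟨by rw [vec_eta p, h0, h0', zero_eq_vec], ?_⟩
    by_contra hc
    simp [h0, h0', hc, Equiv.Perm.SameCycle.refl] at h4
  · left
    have : (p 1 : ℝ) ≠ 0 := fun hh => h0' (Subtype.ext hh)
    simp [h0, hne, this] at h2
    exact h2.symm
  · left
    have : (p 0 : ℝ) ≠ 0 := fun hh => h0 (Subtype.ext hh)
    simp [h0', hne, this] at h3
    exact h3.symm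
  · left
    simp [h0, h0', hne] at h1
    exact h1.symm

instance : T2Space O.Surface :=
  .of_injective_continuous injective_separate (continuous_toTorus.prodMk (continuous_pi fun s =>
    (continuous_sepFace s).prodMk ((continuous_sepVert s).prodMk
      ((continuous_sepHor s).prodMk (continuous_sepCorner s)))))

theorem isClosedMap_pt : IsClosedMap fun q : O.Squares => (pt q.1 q.2 : O.Surface) :=
  isQuotientMap_pt.continuous.isClosedMap

/-- The gluing map is closed, being continuous from a compact to a Hausdorff space. Hence a
neighbourhood of a whole fibre contains the preimage of a neighbourhood of the point. -/
theorem eventually_nhds_of_forall_pt {x : O.Surface} {P : O.Surface → Prop}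
    (h : ∀ s p, pt s p = x → ∀ᶠ q in 𝓝 p, P (pt s q)) : ∀ᶠ y in 𝓝 x, P y := by
  have := isClosedMap_pt.eventually_nhds_fiber (p := fun q : O.Squares => P (pt q.1 q.2)) x (by
    rintro ⟨s, p⟩ hx
    rw [Sigma.nhds_mk, Filter.eventually_map]
    exact h s p hx)
  filter_upwards [this] with y hy
  obtain ⟨q, rfl⟩ := pt_surjective y
  exact hy q rfl

theorem finite_fiber (x : O.Surface) : {q : O.Squares | pt q.1 q.2 = x}.Finite := by
  obtain ⟨s, p, hp, rfl⟩ := exists_eq_pt x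
  have hf : (Set.univ.pi fun i => ({p i, 1} : Set I)).Finite := Set.Finite.pi fun i => by simp
  refine ((Set.toFinite (Set.univ : Set O.Sq)).prod hf |>.image
    (fun z => (⟨z.1, z.2⟩ : O.Squares))).subset ?_
  rintro ⟨s', p'⟩ h
  refine ⟨(s', p'), ⟨trivial, fun i _ => ?_⟩, rfl⟩
  have := congrFun (pt_eq_iff.1 h).1 i
  rw [lowPt_of_ne hp, lowPt] at this
  by_cases h1 : p' i = 1
  · exact .inr h1
  · rw [low_of_ne h1] at this; exact .inl this

/-! ### Steps inside a square -/

/-- Some square contains points which represent `x` and `y` and differ by the vector `v`. -/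
def Step (x y : O.Surface) (v : Fin 2 → ℝ) : Prop :=
  ∃ s p q, pt s p = x ∧ pt s q = y ∧ toPlane q - toPlane p = v

theorem step_pt (s : O.Sq) (p q : Fin 2 → I) :
    Step (pt s p : O.Surface) (pt s q) (toPlane q - toPlane p) := ⟨s, p, q, rfl, rfl, rfl⟩

theorem isometry_toPlane : Isometry toPlane :=
  Isometry.piMap (fun _ => Subtype.val) fun _ => isometry_subtype_coe

theorem continuous_toPlane : Continuous toPlane := isometry_toPlane.continuous

theorem norm_toPlane_sub (p q : Fin 2 → I) : ‖toPlane q - toPlane p‖ = dist q p := by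
  rw [← dist_eq_norm, isometry_toPlane.dist_eq]

theorem eventually_norm_toPlane_sub_lt (p : Fin 2 → I) {δ : ℝ} (hδ : 0 < δ) :
    ∀ᶠ q in 𝓝 p, ‖toPlane q - toPlane p‖ < δ := by
  simp only [norm_toPlane_sub]
  exact Metric.ball_mem_nhds p hδ

/-- A point has only finitely many representatives, so one radius serves all of them. -/
theorem forall_step_of_eventually {x : O.Surface} {R : O.Surface → (Fin 2 → ℝ) → Prop}
    (h : ∀ s p, pt s p = x → ∀ᶠ q in 𝓝 p, R (pt s q) (toPlane q - toPlane p)) :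
    ∃ δ > 0, ∀ y v, ‖v‖ < δ → Step x y v → R y v := by
  have key : ∀ᶠ δ in 𝓝[>] (0 : ℝ), ∀ z ∈ {q : O.Squares | pt q.1 q.2 = x},
      ∀ q, dist q z.2 < δ → R (pt z.1 q) (toPlane q - toPlane z.2) := by
    rw [(finite_fiber x).eventually_all]
    rintro ⟨s, p⟩ hz
    obtain ⟨ε, hε, hball⟩ := Metric.eventually_nhds_iff.1 (h s p hz)
    filter_upwards [Ioo_mem_nhdsGT hε] with δ hδ q hq
    exact hball (hq.trans hδ.2)
  obtain ⟨δ, hδ, hpos⟩ := (key.and self_mem_nhdsWithin).exists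
  refine ⟨δ, hpos, ?_⟩
  rintro _ _ hv ⟨s, p, q, hx, rfl, rfl⟩
  exact hδ ⟨s, p⟩ hx q (by rwa [norm_toPlane_sub] at hv)

theorem eventually_step (x : O.Surface) {δ : ℝ} (hδ : 0 < δ) :
    ∀ᶠ y in 𝓝 x, ∃ v, ‖v‖ < δ ∧ Step x y v := by
  refine eventually_nhds_of_forall_pt ?_
  rintro s p rfl
  filter_upwards [eventually_norm_toPlane_sub_lt p hδ] with q hq
  exact ⟨_, hq, step_pt s p q⟩

theorem Step.toTorus_eq {x y : O.Surface} {v : Fin 2 → ℝ} (h : Step x y v) :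
    toTorus y = toTorus x + fun i => (v i : UnitAddCircle) := by
  obtain ⟨s, p, q, rfl, rfl, rfl⟩ := h
  ext i
  simp [toTorus_pt]

/-- An endpoint of the interval can be represented by 0 for moves to the right and by 1 for moves to
the left, so small moves in both directions stay in [0,1]. -/
theorem exists_coord_add (t : I) :
    ∃ δ > 0, ∀ v : ℝ, |v| < δ → ∃ a b : I, low a = low t ∧ (b : ℝ) - a = v := by
  by_cases h : 0 < (t : ℝ) ∧ (t : ℝ) < 1
  · refine ⟨min t (1 - t), lt_min h.1 (by linarith), fun v hv => ?_⟩
    rw [lt_min_iff, abs_lt, abs_lt] at hv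
    exact ⟨t, ⟨t + v, by constructor <;> linarith⟩, rfl, by simp⟩
  · have h0 : low t = 0 := by
      by_cases h1 : t = 1
      · simp [h1]
      · rw [low_of_ne h1]
        by_contra h0
        exact h ⟨lt_of_le_of_ne t.2.1 fun h => h0 (Subtype.ext h.symm),
          lt_of_le_of_ne t.2.2 fun h => h1 (Subtype.ext h)⟩
    refine ⟨1, one_pos, fun v hv => ?_⟩
    rw [abs_lt] at hv
    rw [h0]
    rcases le_total 0 v with hv' | hv'
    · exact ⟨0, ⟨v, hv', hv.2.le⟩, by simp, by simp⟩
    · exact ⟨1, ⟨1 + v, by linarith, by linarith⟩, by simp, by simp⟩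

/-- For fixed coordinates `a`, the map `lowSq` is a permutation of the squares. The witness is its
inverse, which undoes the up move before the right move. -/
theorem exists_pt_eq {s : O.Sq} {p a : Fin 2 → I} (h : lowPt a = lowPt p) :
    ∃ s', (pt s' a : O.Surface) = pt s p := by
  classical
  refine ⟨(if a 0 = 1 then O.right⁻¹ else 1) ((if a 1 = 1 then O.up⁻¹ else 1) (lowSq s p)), ?_⟩
  rw [← pt_low s p, ← pt_low _ a, h]
  congr 1
  unfold lowSq
  split_ifs <;> simp

theorem exists_step (x : O.Surface) : ∃ δ > 0, ∀ v, ‖v‖ < δ → ∃ y, Step x y v := by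
  obtain ⟨s, p, -, rfl⟩ := exists_eq_pt x
  choose δ hδ h using fun i => exists_coord_add (p i)
  refine ⟨min (δ 0) (δ 1), lt_min (hδ 0) (hδ 1), fun v hv => ?_⟩
  have hv : ∀ i, |v i| < δ i := fun i => (norm_le_pi_norm v i).trans_lt
    (hv.trans_le (by fin_cases i <;> simp))
  choose a b ha hb using fun i => h i (v i) (hv i)
  obtain ⟨s', hs'⟩ := exists_pt_eq (s := s) (p := p) (a := a) (funext ha)
  exact ⟨pt s' b, s', a, b, hs', rfl, funext hb⟩

/-! ### Regular points -/

/-- Each point of the unit square is in at most one square glued to `x`. -/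
def IsRegular (x : O.Surface) : Prop :=
  ∀ s s' p, pt s p = x → pt s' p = x → s = s'

theorem low_eq_low_iff {a p : I} :
    low a = low p ↔ a = p ∨ a = 0 ∧ p = 1 ∨ a = 1 ∧ p = 0 := by
  by_cases ha : a = 1 <;> by_cases hp : p = 1 <;> simp [ha, hp, low_of_ne]
  · grind

/-- If `a` and `p` differ in a coordinate, one is 0 and the other 1 there, so the common
displacement is both nonnegative and nonpositive. It vanishes in that coordinate, the step runs
along an edge, and it can be moved to the neighbouring square. -/
theorem exists_pt_step_eq {s : O.Sq} {p q a b : Fin 2 → I} (ha : lowPt a = lowPt p)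
    (h : toPlane q - toPlane p = toPlane b - toPlane a) :
    ∃ s' : O.Sq, pt s' a = pt s p ∧ pt s' b = pt s q := by
  have key : ∀ i, a i = p i ∧ b i = q i ∨ a i = 0 ∧ b i = 0 ∧ p i = 1 ∧ q i = 1 ∨
      a i = 1 ∧ b i = 1 ∧ p i = 0 ∧ q i = 0 := fun i => by
    have h1 := low_eq_low_iff.1 (congrFun ha i)
    have h2 : (q i : ℝ) - p i = b i - a i := congrFun h i
    rcases h1 with h1 | ⟨h1, h3⟩ | ⟨h1, h3⟩
    · exact .inl ⟨h1, Subtype.ext (by rw [h1] at h2; linarith)⟩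
    · rw [h1, h3, Set.Icc.coe_zero, Set.Icc.coe_one] at h2
      have := (q i).2.2
      have := (b i).2.1
      exact .inr (.inl ⟨h1, Subtype.ext (by rw [Set.Icc.coe_zero]; linarith), h3,
        Subtype.ext (by rw [Set.Icc.coe_one]; linarith)⟩)
    · rw [h1, h3, Set.Icc.coe_zero, Set.Icc.coe_one] at h2
      have := (b i).2.2
      have := (q i).2.1
      exact .inr (.inr ⟨h1, Subtype.ext (by rw [Set.Icc.coe_one]; linarith), h3,
        Subtype.ext (by rw [Set.Icc.coe_zero]; linarith)⟩)
  have step0 : ∃ s' : O.Sq, pt s' ![a 0, p 1] = pt s p ∧ pt s' ![b 0, q 1] = pt s q := by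
    rw [vec_eta p, vec_eta q]
    rcases key 0 with ⟨h1, h2⟩ | ⟨h1, h2, h3, h4⟩ | ⟨h1, h2, h3, h4⟩
    · exact ⟨s, by simp [h1], by simp [h2]⟩
    · exact ⟨O.right s, by simp [h1, h3, pt_right], by simp [h2, h4, pt_right]⟩
    · exact ⟨O.right⁻¹ s, by simp [h1, h3, pt_right], by simp [h2, h4, pt_right]⟩
  obtain ⟨s1, hp, hq⟩ := step0
  rw [← hp, ← hq, vec_eta a, vec_eta b]
  rcases key 1 with ⟨h1, h2⟩ | ⟨h1, h2, h3, h4⟩ | ⟨h1, h2, h3, h4⟩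
  · exact ⟨s1, by simp [h1], by simp [h2]⟩
  · exact ⟨O.up s1, by simp [h1, h3, pt_up], by simp [h2, h4, pt_up]⟩
  · exact ⟨O.up⁻¹ s1, by simp [h1, h3, pt_up], by simp [h2, h4, pt_up]⟩

/-- Any step from x can be rewritten to start at the same coordinates as another with the same
vector; regularity then forces the same square. -/
theorem IsRegular.step_unique {x y y' : O.Surface} {v : Fin 2 → ℝ} (hx : IsRegular x)
    (h : Step x y v) (h' : Step x y' v) : y = y' := by
  obtain ⟨s, p, q, hp, rfl, rfl⟩ := h
  obtain ⟨s', p', q', hp', rfl, hv⟩ := h'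
  obtain ⟨s1, h1, h2⟩ := exists_pt_step_eq (s := s) (p := p) (q := q) (a := p') (b := q')
    (pt_eq_iff.1 (hp'.trans hp.symm)).1 hv.symm
  rw [← h2, hx s1 s' p' (h1.trans hp) hp']

/-! ### The interior of a square -/

/-- The interior of the unit square. -/
def interiorSquare : Set (Fin 2 → I) := Set.univ.pi fun _ => Set.Ioo 0 1

theorem dense_interiorSquare : Dense interiorSquare := dense_pi _ fun i _ => by
  rw [dense_iff_closure_eq, closure_Ioo zero_ne_one]
  exact Set.eq_univ_of_forall fun t => ⟨t.2.1, t.2.2⟩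

theorem exists_interior_of_eventually {p : Fin 2 → I} {P : (Fin 2 → I) → Prop}
    (h : ∀ᶠ q in 𝓝 p, P q) : ∃ q ∈ interiorSquare, P q :=
  dense_interiorSquare.inter_nhds_nonempty h

theorem ne_one_of_mem_interior {p : Fin 2 → I} (h : p ∈ interiorSquare) (i : Fin 2) : p i ≠ 1 :=
  (h i trivial).2.ne

theorem ne_zero_of_mem_interior {p : Fin 2 → I} (h : p ∈ interiorSquare) (i : Fin 2) : p i ≠ 0 :=
  (h i trivial).1.ne'

theorem pt_eq_iff_of_mem_interior {s s' : O.Sq} {p p' : Fin 2 → I} (hp : p ∈ interiorSquare)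
    (hp' : p' ∈ interiorSquare) : pt s p = pt s' p' ↔ p = p' ∧ s = s' := by
  rw [pt_eq_iff_of_ne (ne_one_of_mem_interior hp) (ne_one_of_mem_interior hp')]
  refine and_congr_right fun _ => or_iff_left ?_
  rintro ⟨rfl, -⟩
  exact ne_zero_of_mem_interior hp 0 rfl

/-! ### Charts and singularities -/

/-- The representative in `[-1/2, 1/2)` of an element of `ℝ / ℤ`. -/
def circleLift (a : UnitAddCircle) : ℝ := (AddCircle.equivIco 1 (-1 / 2 : ℝ) a : ℝ)

theorem circleLift_coe {v : ℝ} (h : |v| < 1 / 2) : circleLift v = v := by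
  rw [abs_lt] at h
  rw [circleLift, AddCircle.equivIco_coe_eq ⟨by linarith, by linarith⟩]

theorem continuousAt_circleLift {v : ℝ} (h : |v| < 1 / 2) :
    ContinuousAt circleLift (v : UnitAddCircle) := by
  refine continuous_subtype_val.continuousAt.comp (AddCircle.continuousAt_equivIco 1 _ ?_)
  intro heq
  rw [abs_lt] at h
  rw [AddCircle.coe_eq_coe_iff_of_mem_Ico (a := -1 / 2) ⟨by linarith, by linarith⟩
    ⟨by linarith, by linarith⟩] at heq
  linarith

/-- The coordinates of a point relative to a point near it. -/
def localCoord (x y : O.Surface) : Fin 2 → ℝ := fun i => circleLift (toTorus y i - toTorus x i)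

theorem localCoord_of_toTorus {x y : O.Surface} {v : Fin 2 → ℝ}
    (h : toTorus y = toTorus x + fun i => (v i : UnitAddCircle)) (hv : ‖v‖ < 1 / 2) :
    localCoord x y = v := by
  ext i
  rw [localCoord, h, Pi.add_apply, add_sub_cancel_left,
    circleLift_coe ((norm_le_pi_norm v i).trans_lt hv)]

theorem Step.localCoord_eq {x y : O.Surface} {v : Fin 2 → ℝ} (h : Step x y v)
    (hv : ‖v‖ < 1 / 2) : localCoord x y = v :=
  localCoord_of_toTorus h.toTorus_eq hv

theorem Step.continuousAt_localCoord {x y : O.Surface} {v : Fin 2 → ℝ} (h : Step x y v)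
    (hv : ‖v‖ < 1 / 2) : ContinuousAt (localCoord x) y := by
  refine continuousAt_pi.2 fun i => ?_
  have hc : Continuous fun z : O.Surface => toTorus z i - toTorus x i :=
    ((continuous_apply i).comp continuous_toTorus).sub continuous_const
  refine ContinuousAt.comp (f := fun z : O.Surface => toTorus z i - toTorus x i)
    (g := circleLift) ?_ hc.continuousAt
  rw [h.toTorus_eq, Pi.add_apply, add_sub_cancel_left]
  exact continuousAt_circleLift ((norm_le_pi_norm v i).trans_lt hv)

theorem isCompact_setOf_step (x : O.Surface) (δ : ℝ) :
    IsCompact {y | ∃ v, ‖v‖ ≤ δ ∧ Step x y v} := by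
  have : {y | ∃ v, ‖v‖ ≤ δ ∧ Step x y v} = ⋃ z ∈ {q : O.Squares | pt q.1 q.2 = x},
      pt z.1 '' Metric.closedBall z.2 δ := by
    ext y
    simp only [Set.mem_iUnion, Set.mem_ofPred_eq, Set.mem_image, Metric.mem_closedBall]
    constructor
    · rintro ⟨_, hv, s, p, q, hx, rfl, rfl⟩
      exact ⟨⟨s, p⟩, hx, q, by rwa [norm_toPlane_sub] at hv, rfl⟩
    · rintro ⟨⟨s, p⟩, hx, q, hq, rfl⟩
      exact ⟨_, by rwa [norm_toPlane_sub], s, p, q, hx, rfl, rfl⟩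
  rw [this]
  exact (finite_fiber x).isCompact_biUnion fun z _ =>
    (isCompact_closedBall z.2 δ).image (continuous_pt z.1)

/-- The chart is the difference of torus coordinates, lifted to ℝ² near 0. Its inverse sends v to
the end of the step with vector v from x: small steps exist at every point, and regularity makes
their ends unique. -/
theorem IsRegular.exists_chart {x : O.Surface} (hx : IsRegular x) :
    ∃ e : OpenPartialHomeomorph O.Surface (Fin 2 → ℝ), IsTranslationChart e ∧ x ∈ e.source := by
  obtain ⟨ε, hε, hstep⟩ := exists_step x
  -- With the bound 1/4, the sum of two small displacements stays below 1/2, where the lift from the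
  -- circle recovers it.
  obtain ⟨δ, hδ, hδε, hδ4⟩ : ∃ δ > 0, δ < ε ∧ δ < 1 / 4 :=
    ⟨min ε (1 / 4) / 2, by positivity, by
      have := min_le_left ε (1 / 4); have : 0 < min ε (1 / 4) := by positivity
      linarith, by
      have := min_le_right ε (1 / 4); have : 0 < min ε (1 / 4) := by positivity
      linarith⟩
  let E : Set O.Surface := {y | ∃ v, ‖v‖ ≤ δ ∧ Step x y v}
  have hE : IsCompact E := isCompact_setOf_step x δ
  have : Nonempty O.Surface := ⟨x⟩
  choose! D hD using fun v (hv : v ∈ Metric.closedBall (0 : Fin 2 → ℝ) δ) =>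
    hstep v ((mem_closedBall_zero_iff.1 hv).trans_lt hδε)
  let e : O.Surface → Fin 2 → ℝ := localCoord x
  have he : ∀ {y v}, Step x y v → ‖v‖ ≤ δ → e y = v := fun h hv =>
    h.localCoord_eq (hv.trans_lt (by linarith))
  have heD : ∀ v ∈ Metric.closedBall (0 : Fin 2 → ℝ) δ, e (D v) = v := fun v hv =>
    he (hD v hv) (mem_closedBall_zero_iff.1 hv)
  have hDe : ∀ y ∈ E, e y ∈ Metric.closedBall 0 δ ∧ D (e y) = y := by
    rintro y ⟨v, hv, hy⟩
    have hv' : v ∈ Metric.closedBall 0 δ := mem_closedBall_zero_iff.2 hv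
    rw [he hy hv]
    exact ⟨hv', hx.step_unique (hD v hv') hy⟩
  have hec : ∀ y ∈ E, ContinuousAt e y := by
    rintro y ⟨v, hv, hy⟩
    exact hy.continuousAt_localCoord (hv.trans_lt (by linarith))
  -- The preimage of a closed set `C` under `D` is the image under `e` of the compact set `E ∩ C`,
  -- hence closed.
  have hDc : ContinuousOn D (Metric.closedBall 0 δ) := by
    rw [continuousOn_iff_isClosed]
    intro C hC
    refine ⟨e '' (E ∩ C), ((hE.inter_right hC).image_of_continuousOn fun y hy =>
      (hec y hy.1).continuousWithinAt).isClosed, ?_⟩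
    ext v
    constructor
    · rintro ⟨h1, h2⟩
      exact ⟨⟨D v, ⟨⟨v, mem_closedBall_zero_iff.1 h2, hD v h2⟩, h1⟩, heD v h2⟩, h2⟩
    · rintro ⟨⟨y, ⟨hyE, hyC⟩, rfl⟩, h2⟩
      refine ⟨?_, h2⟩
      rw [Set.mem_preimage, (hDe y hyE).2]
      exact hyC
  have hxx : Step x x 0 := by
    obtain ⟨s, p, -, rfl⟩ := exists_eq_pt x
    simpa using step_pt s p p
  have hex : e x = 0 := he hxx (by simpa using hδ.le)
  have h0 : (0 : Fin 2 → ℝ) ∈ Metric.closedBall 0 δ := by simpa using hδ.le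
  have hNx : x ∈ interior E := mem_interior_iff_mem_nhds.2 <|
    (eventually_step x hδ).mono fun y ⟨v, hv, h⟩ => ⟨v, hv.le, h⟩
  have hD0 : D 0 = x := hx.step_unique (hD 0 h0) hxx
  -- The ball is shrunk until `D` maps it into the interior of `E`, so that the chart has an open
  -- source.
  obtain ⟨δ', hδ', hball⟩ : ∃ δ' > 0, ∀ v, ‖v‖ < δ' → ‖v‖ ≤ δ ∧ D v ∈ interior E := by
    have h1 : ∀ᶠ v in 𝓝 (0 : Fin 2 → ℝ), D v ∈ interior E :=
      (hDc.continuousAt (Metric.closedBall_mem_nhds 0 hδ)) (by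
        rw [hD0]; exact isOpen_interior.mem_nhds hNx)
    obtain ⟨r, hr, h⟩ := Metric.eventually_nhds_iff.1 h1
    refine ⟨min r δ, lt_min hr hδ, fun v hv => ⟨(hv.trans_le (min_le_right _ _)).le, h ?_⟩⟩
    rw [dist_zero_right]; exact hv.trans_le (min_le_left _ _)
  have hecN : ContinuousOn e (interior E) := fun y hy =>
    (hec y (interior_subset hy)).continuousWithinAt
  refine ⟨
    { toFun := e
      invFun := D
      source := interior E ∩ e ⁻¹' Metric.ball 0 δ'
      target := Metric.ball 0 δ'
      map_source' := fun y hy => hy.2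
      map_target' := fun v hv => by
        have := hball v (mem_ball_zero_iff.1 hv)
        refine ⟨this.2, ?_⟩
        rw [Set.mem_preimage, heD v (mem_closedBall_zero_iff.2 this.1)]
        exact hv
      left_inv' := fun y hy => (hDe y (interior_subset hy.1)).2
      right_inv' := fun v hv =>
        heD v (mem_closedBall_zero_iff.2 (hball v (mem_ball_zero_iff.1 hv)).1)
      open_source := hecN.isOpen_inter_preimage isOpen_interior Metric.isOpen_ball
      open_target := Metric.isOpen_ball
      continuousOn_toFun := hecN.mono Set.inter_subset_left
      continuousOn_invFun := hDc.mono fun v hv =>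
        mem_closedBall_zero_iff.2 (hball v (mem_ball_zero_iff.1 hv)).1 }, ?_, hNx, ?_⟩
  · intro s p hp
    obtain ⟨v, hv, hs⟩ := interior_subset hp.1
    filter_upwards [eventually_norm_toPlane_sub_lt p (show (0 : ℝ) < 1 / 4 by norm_num)] with q hq
    change e (pt s q) = e (pt s p) + _
    rw [he hs hv]
    refine localCoord_of_toTorus ?_ ((norm_add_le _ _).trans_lt (by linarith))
    rw [(step_pt s p q).toTorus_eq, hs.toTorus_eq]
    ext i
    simp [add_assoc]
  · change e x ∈ Metric.ball 0 δ'
    rw [hex]; simpa using hδ'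

/-- If two squares represented x at the same coordinates, the chart would take equal values at
nearby interior points of both, and injectivity would identify the squares. -/
theorem IsTranslationChart.isRegular {e : OpenPartialHomeomorph O.Surface (Fin 2 → ℝ)}
    (he : IsTranslationChart e) {x : O.Surface} (hx : x ∈ e.source) : IsRegular x := by
  rintro s s' p rfl hp'
  have hc : ∀ s, pt s p ∈ e.source → ∀ᶠ q in 𝓝 p, pt s q ∈ e.source := fun s hs =>
    (continuous_pt s).continuousAt (e.open_source.mem_nhds hs)
  have hx' : pt s' p ∈ e.source := hp' ▸ hx
  obtain ⟨q, hq, h1, h2, h3, h4⟩ := exists_interior_of_eventually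
    ((hc s hx).and ((hc s' hx').and ((he s p hx).and (he s' p hx'))))
  rw [hp', ← h3] at h4
  have := e.injOn h2 h1 h4
  exact (pt_eq_iff_of_mem_interior hq hq).1 this.symm |>.2

theorem mem_singularities_iff {x : O.Surface} : x ∈ O.singularities ↔ ¬ IsRegular x :=
  ⟨fun h hx => let ⟨e, he, hxe⟩ := hx.exists_chart; h e he hxe,
    fun h _ he hxe => h (he.isRegular hxe)⟩

theorem isRegular_pt_of_ne {s : O.Sq} {p : Fin 2 → I} (h : ∃ i, lowPt p i ≠ 0) :
    IsRegular (pt s p) := by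
  obtain ⟨i, hi⟩ := h
  intro s1 s2 q h1 h2
  have h := pt_eq_iff.1 (h1.trans h2.symm)
  rcases h.2 with h' | h'
  · classical
    unfold lowSq at h'
    split_ifs at h' <;> simpa using h'
  · rw [(pt_eq_iff.1 h1).1] at h'
    exact absurd (congrFun h'.1 i) hi

/-- All squares at the vertex have their normal square in the cycle of s; if that cycle is {s}, each
representative is determined by its coordinates. -/
theorem isRegular_corner_iff {s : O.Sq} : IsRegular (corner s) ↔ O.comm s = s := by
  constructor
  · intro h
    exact h _ _ 0 (corner_comm s) rfl
  · intro h s1 s2 p h1 h2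
    have key : ∀ s', pt s' p = corner s → lowSq s' p = s := fun s' h' => by
      rw [corner, pt_eq_iff, lowSq_of_ne (p := 0) (by simp)] at h'
      rcases h'.2 with h' | h'
      · exact h'
      · exact (h'.2.symm.eq_of_left h).symm
    have := (key s1 h1).trans (key s2 h2).symm
    classical
    unfold lowSq at this
    split_ifs at this <;> simpa using this

theorem mem_singularities_iff_exists {x : O.Surface} :
    x ∈ O.singularities ↔ ∃ s, O.comm s ≠ s ∧ x = corner s := by
  constructor
  · intro h
    obtain ⟨s, p, hp, rfl⟩ := exists_eq_pt x
    have h0 : p = 0 := by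
      by_contra h0
      obtain ⟨i, hi⟩ := Function.ne_iff.1 h0
      exact mem_singularities_iff.1 h (isRegular_pt_of_ne ⟨i, by rwa [lowPt_of_ne hp]⟩)
    subst h0
    exact ⟨s, fun hs => mem_singularities_iff.1 h (isRegular_corner_iff.2 hs), rfl⟩
  · rintro ⟨s, hs, rfl⟩
    exact mem_singularities_iff.2 fun h => hs (isRegular_corner_iff.1 h)

theorem toTorus_corner (s : O.Sq) : toTorus (corner s) = 0 := by
  rw [corner, toTorus_pt]
  ext i; simp [toPlane]

theorem toTorus_eq_zero_of_mem_singularities {x : O.Surface} (h : x ∈ O.singularities) :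
    toTorus x = 0 := by
  obtain ⟨s, -, rfl⟩ := mem_singularities_iff_exists.1 h
  exact toTorus_corner s

theorem finite_singularities : O.singularities.Finite :=
  (Set.finite_range corner).subset fun x hx => by
    obtain ⟨s, -, rfl⟩ := mem_singularities_iff_exists.1 hx
    exact ⟨s, rfl⟩

/-! ### Cone angles -/

/-- The squares which contain the point with coordinates `p ∈ [0, 1)²` glued to the point `p` of
the square `s`. -/
def sheets (s : O.Sq) (p : Fin 2 → I) : Set O.Sq :=
  {s' | s = s' ∨ p = 0 ∧ O.comm.SameCycle s s'}

open Classical in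
/-- The points of the unit square with the same image in the torus as `p ∈ [0, 1)²`. -/
def lifts (p : Fin 2 → I) : Finset (Fin 2 → I) :=
  Fintype.piFinset fun i => if p i = 0 then {0, 1} else {p i}

theorem mem_lifts_iff {p a : Fin 2 → I} (hp : ∀ i, p i ≠ 1) : a ∈ lifts p ↔ lowPt a = p := by
  rw [lifts, Fintype.mem_piFinset, funext_iff]
  refine forall_congr' fun i => ?_
  rw [lowPt]
  by_cases ha : a i = 1
  · rw [ha, low_one]
    split_ifs with h
    · simp [h]
    · simp [Ne.symm h, (hp i).symm]
  · rw [low_of_ne ha]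
    split_ifs with h
    · simp [h, ha]
    · simp

/-- The sum of products is a product of sums, and each coordinate contributes 1: either 1/2 + 1/2
from the two endpoints, or a single interior value. -/
theorem sum_lifts (p : Fin 2 → I) (hp : ∀ i, p i ≠ 1) :
    ∑ a ∈ lifts p, squareAngle a = 2 * Real.pi := by
  classical
  simp only [squareAngle, ← Finset.mul_sum]
  have := Finset.prod_univ_sum (fun i : Fin 2 => if p i = 0 then {0, 1} else ({p i} : Finset I))
    (fun _ t => if t = 0 ∨ t = 1 then (1 / 2 : ℝ) else 1)
  rw [lifts]
  have h1 : ∏ i : Fin 2, ∑ t ∈ (if p i = 0 then {0, 1} else ({p i} : Finset I)),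
      (if t = 0 ∨ t = 1 then (1 / 2 : ℝ) else 1) = 1 := by
    refine Finset.prod_eq_one fun i _ => ?_
    split_ifs with h
    · rw [Finset.sum_pair zero_ne_one]; norm_num
    · rw [Finset.sum_singleton, if_neg (by simp [h, hp i])]
  rw [h1] at this
  refine (congrArg (2 * Real.pi * ·) ?_).trans (mul_one _)
  convert this.symm

theorem lowSq_bijective (a : Fin 2 → I) :
    Function.Bijective fun s : O.Sq => lowSq s a := by
  classical
  exact ((if a 1 = 1 then O.up else 1) * (if a 0 = 1 then O.right else 1)).bijective

/-- Representatives of the point correspond to pairs of a sheet and a lift of the coordinates, by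
passing to the normal square. Each sheet thus contributes a full angle 2π. -/
theorem coneAngle_eq {s : O.Sq} {p : Fin 2 → I} (hp : ∀ i, p i ≠ 1) :
    coneAngle (pt s p) = (sheets s p).ncard * (2 * Real.pi) := by
  have hiff : ∀ q : O.Squares, pt q.1 q.2 = (pt s p : O.Surface) ↔
      q.2 ∈ lifts p ∧ lowSq q.1 q.2 ∈ sheets s p := fun q => by
    rw [eq_comm, pt_eq_iff, lowPt_of_ne hp, lowSq_of_ne hp, mem_lifts_iff hp, eq_comm]
    rfl
  let e : {q : O.Squares // pt q.1 q.2 = (pt s p : O.Surface)} → sheets s p × lifts p :=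
    fun q => (⟨lowSq q.1.1 q.1.2, ((hiff q.1).1 q.2).2⟩, ⟨q.1.2, ((hiff q.1).1 q.2).1⟩)
  have he : Function.Bijective e := by
    constructor
    · rintro ⟨⟨s1, a1⟩, h1⟩ ⟨⟨s2, a2⟩, h2⟩ h
      simp only [e, Prod.mk.injEq, Subtype.mk.injEq] at h
      obtain ⟨h, rfl⟩ := h
      obtain rfl := (lowSq_bijective a1).1 h
      rfl
    · rintro ⟨⟨k, hk⟩, ⟨a, ha⟩⟩
      obtain ⟨s', rfl⟩ := (lowSq_bijective a).2 k
      exact ⟨⟨⟨s', a⟩, (hiff _).2 ⟨ha, hk⟩⟩, rfl⟩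
  rw [coneAngle, finsum_eq_of_bijective e he (g := fun z => squareAngle z.2.1) fun _ => rfl]
  have := Fintype.ofFinite (sheets s p)
  rw [finsum_eq_sum_of_fintype, Fintype.sum_prod_type]
  simp only [Finset.sum_const, Finset.card_univ]
  rw [Finset.sum_coe_sort (lifts p) squareAngle, sum_lifts p hp, nsmul_eq_mul,
    ← Nat.card_eq_fintype_card, Nat.card_coe_set_eq]

theorem coneAngle_of_isRegular {x : O.Surface} (hx : IsRegular x) :
    coneAngle x = 2 * Real.pi := by
  obtain ⟨s, p, hp, rfl⟩ := exists_eq_pt x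
  have : sheets s p = {s} := by
    ext s'
    refine ⟨fun h => ?_, fun h => .inl h.symm⟩
    exact hx s' s p ((pt_eq_iff_of_ne hp hp).2 ⟨rfl, h⟩).symm rfl
  rw [coneAngle_eq hp, this, Set.ncard_singleton, Nat.cast_one, one_mul]

theorem coneAngle_corner (s : O.Sq) :
    coneAngle (corner s) = {s' | O.comm.SameCycle s s'}.ncard * (2 * Real.pi) := by
  rw [corner, coneAngle_eq (by simp)]
  congr 3
  ext s'
  exact ⟨fun h => h.elim (fun h => h ▸ .rfl) And.right, fun h => .inr ⟨rfl, h⟩⟩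

/-! ### Maps which are affine in the coordinates of the squares -/

/-- Near each point, steps inside squares are mapped to steps inside squares by the matrix `A`. -/
def IsStepAffine (f : O.Surface → O'.Surface) (A : Matrix (Fin 2) (Fin 2) ℝ) : Prop :=
  ∀ x, ∃ δ > 0, ∀ y v, ‖v‖ < δ → Step x y v → Step (f x) (f y) (A *ᵥ v)

theorem IsTranslationChart.apply_of_step {e : OpenPartialHomeomorph O.Surface (Fin 2 → ℝ)}
    (he : IsTranslationChart e) {x : O.Surface} (hx : x ∈ e.source) :
    ∃ δ > 0, ∀ y v, ‖v‖ < δ → Step x y v → e y = e x + v :=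
  forall_step_of_eventually (R := fun y v => e y = e x + v) fun s p h => by
    subst h
    exact he s p hx

theorem exists_norm_mulVec_lt (A : Matrix (Fin 2) (Fin 2) ℝ) {δ : ℝ} (hδ : 0 < δ) :
    ∃ δ' > 0, ∀ v, ‖v‖ < δ' → ‖A *ᵥ v‖ < δ := by
  have hc : Continuous fun v : Fin 2 → ℝ => ‖A *ᵥ v‖ := by fun_prop
  have := hc.tendsto 0
  simp only [mulVec_zero, norm_zero] at this
  obtain ⟨r, hr, h⟩ := Metric.eventually_nhds_iff.1 (this.eventually_lt_const hδ)
  exact ⟨r, hr, fun v hv => h (by rwa [dist_zero_right])⟩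

theorem IsStepAffine.eventually_eq {f : O.Surface → O'.Surface} {A : Matrix (Fin 2) (Fin 2) ℝ}
    (hf : IsStepAffine f A) {e : OpenPartialHomeomorph O.Surface (Fin 2 → ℝ)}
    {e' : OpenPartialHomeomorph O'.Surface (Fin 2 → ℝ)} (he : IsTranslationChart e)
    (he' : IsTranslationChart e') {x : O.Surface} (hx : x ∈ e.source) (hx' : f x ∈ e'.source) :
    ∀ᶠ y in 𝓝 x, e' (f y) = e' (f x) + A *ᵥ (e y - e x) := by
  obtain ⟨δ1, h1, H1⟩ := he.apply_of_step hx
  obtain ⟨δ2, h2, H2⟩ := he'.apply_of_step hx'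
  obtain ⟨δ3, h3, H3⟩ := exists_norm_mulVec_lt A h2
  obtain ⟨δ4, h4, H4⟩ := hf x
  filter_upwards [eventually_step x (lt_min h1 (lt_min h3 h4))] with y ⟨v, hv, hs⟩
  rw [lt_min_iff, lt_min_iff] at hv
  rw [H1 y v hv.1 hs, add_sub_cancel_left]
  exact H2 _ _ (H3 v hv.2.1) (H4 y v hv.2.2 hs)

theorem IsStepAffine.isLocalTranslation {f : O.Surface → O'.Surface} (hf : IsStepAffine f 1) :
    IsLocalTranslation f := fun e e' he he' x hx hx' => by
  simpa using hf.eventually_eq he he' hx hx'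

/-- Two squares representing x at the same coordinates give steps with equal vectors; their images
are steps from the regular point `f x` with equal vectors, so they end at the same point. -/
theorem IsStepAffine.isRegular {f : O.Surface → O'.Surface} {A : Matrix (Fin 2) (Fin 2) ℝ}
    (hf : IsStepAffine f A) (hinj : Function.Injective f) {x : O.Surface}
    (hx : IsRegular (f x)) : IsRegular x := by
  rintro s s' p rfl hp'
  obtain ⟨δ, hδ, H⟩ := hf (pt s p)
  obtain ⟨q, hq, hqp⟩ := exists_interior_of_eventually (eventually_norm_toPlane_sub_lt p hδ)
  have h1 := H _ _ hqp (step_pt s p q)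
  have h2 := H _ _ hqp (hp' ▸ step_pt s' p q)
  exact ((pt_eq_iff_of_mem_interior hq hq).1 (hinj (hx.step_unique h1 h2))).2

/-- Singularities map to singularities by `IsStepAffine.isRegular`. The set is finite and f
injective, so this inclusion is an equality. -/
theorem IsStepAffine.isAffine {f : O.Surface ≃ₜ O.Surface} {A : SL(2, ℝ)}
    (hf : IsStepAffine f A.1) : IsAffine f A := by
  have hsub : f '' O.singularities ⊆ O.singularities := by
    rintro _ ⟨x, hx, rfl⟩
    rw [mem_singularities_iff] at hx ⊢
    exact fun h => hx (hf.isRegular f.injective h)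
  have heq : f '' O.singularities = O.singularities :=
    Set.eq_of_subset_of_ncard_le hsub (Set.ncard_image_of_injective _ f.injective).ge
      finite_singularities
  refine ⟨fun x => ?_, fun e e' he he' x hx hx' => hf.eventually_eq he he' hx hx'⟩
  conv_lhs => rw [← heq]
  exact f.injective.mem_set_image

/-! ### Affine homeomorphisms and the projection to the torus -/

theorem isPreconnected_interiorSquare : IsPreconnected interiorSquare :=
  isPreconnected_univ_pi fun _ => isPreconnected_Ioo

theorem apply_eq_of_eventually_eq {Y : Type*} {g : (Fin 2 → I) → Y}
    (hg : ∀ p ∈ interiorSquare, ∀ᶠ q in 𝓝 p, q ∈ interiorSquare → g q = g p) {p q : Fin 2 → I}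
    (hp : p ∈ interiorSquare) (hq : q ∈ interiorSquare) : g p = g q := by
  have := isPreconnected_iff_preconnectedSpace.1 isPreconnected_interiorSquare
  have hl : IsLocallyConstant fun z : interiorSquare => g z := by
    rw [IsLocallyConstant.iff_eventually_eq]
    rintro ⟨z, hz⟩
    filter_upwards [continuous_subtype_val.continuousAt (hg z hz)] with y hy
    exact hy y.2
  exact hl.apply_eq_of_preconnectedSpace ⟨p, hp⟩ ⟨q, hq⟩

theorem isRegular_pt_of_mem_interior {s : O.Sq} {p : Fin 2 → I} (hp : p ∈ interiorSquare) :
    IsRegular (pt s p) :=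
  isRegular_pt_of_ne ⟨0, by
    rw [lowPt_of_ne (ne_one_of_mem_interior hp)]; exact ne_zero_of_mem_interior hp 0⟩

theorem IsTranslationChart.toTorus_eq {e : OpenPartialHomeomorph O.Surface (Fin 2 → ℝ)}
    (he : IsTranslationChart e) {x : O.Surface} (hx : x ∈ e.source) :
    ∀ᶠ y in 𝓝 x, toTorus y = toTorus x + fun i => ((e y - e x) i : UnitAddCircle) := by
  obtain ⟨δ, hδ, H⟩ := he.apply_of_step hx
  filter_upwards [eventually_step x hδ] with y ⟨v, hv, hs⟩
  rw [H y v hv hs, add_sub_cancel_left, hs.toTorus_eq]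

theorem IsAffine.eventually_toTorus {f : O.Surface ≃ₜ O.Surface} {A : SL(2, ℝ)}
    (hf : IsAffine f A) {s : O.Sq} {p : Fin 2 → I} (hp : IsRegular (pt s p)) :
    ∀ᶠ q in 𝓝 p, toTorus (f (pt s q)) = toTorus (f (pt s p)) +
      fun i => ((A.1 *ᵥ (toPlane q - toPlane p)) i : UnitAddCircle) := by
  have hfx : IsRegular (f (pt s p)) := by
    by_contra h
    exact mem_singularities_iff.1 ((hf.1 _).1 (mem_singularities_iff.2 h)) hp
  obtain ⟨e, he, hx⟩ := hp.exists_chart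
  obtain ⟨e', he', hx'⟩ := hfx.exists_chart
  have hc := (continuous_pt s).continuousAt (x := p)
  filter_upwards [hc (hf.2 e e' he he' _ hx hx'), he s p hx,
    (f.continuous.continuousAt.comp hc) (he'.toTorus_eq hx')] with q h1 h2 h3
  have h1 : e' (f (pt s q)) = e' (f (pt s p)) + A.1 *ᵥ (e (pt s q) - e (pt s p)) := h1
  have h3 : toTorus (f (pt s q)) = toTorus (f (pt s p)) +
    fun i => ((e' (f (pt s q)) - e' (f (pt s p))) i : UnitAddCircle) := h3
  rw [h3, h1, h2, add_sub_cancel_left, add_sub_cancel_left]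

/-- The point of the statement is that `p` and `q` may be singular corners, where `IsAffine` gives
no local formula. The difference `g` of both sides is locally constant on the connected interior,
and continuity carries the identity to the closed square. -/
theorem IsAffine.toTorus_eq {f : O.Surface ≃ₜ O.Surface} {A : SL(2, ℝ)}
    (hf : IsAffine f A) (s : O.Sq) (p q : Fin 2 → I) :
    toTorus (f (pt s q)) = toTorus (f (pt s p)) +
      fun i => ((A.1 *ᵥ (toPlane q - toPlane p)) i : UnitAddCircle) := by
  let g : (Fin 2 → I) → Fin 2 → UnitAddCircle := fun q =>
    toTorus (f (pt s q)) - fun i => ((A.1 *ᵥ toPlane q) i : UnitAddCircle)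
  have hlin : ∀ p q : Fin 2 → I, (fun i => ((A.1 *ᵥ (toPlane q - toPlane p)) i : UnitAddCircle)) =
      (fun i => ((A.1 *ᵥ toPlane q) i : UnitAddCircle)) -
        fun i => ((A.1 *ᵥ toPlane p) i : UnitAddCircle) := fun p q => by
    ext i; simp [mulVec_sub]
  have hgc : Continuous g := by
    refine (continuous_toTorus.comp (f.continuous.comp (continuous_pt s))).sub
      (continuous_pi fun i => (AddCircle.continuous_mk' 1).comp ?_)
    exact (continuous_apply i).comp (continuous_const.matrix_mulVec continuous_toPlane)
  obtain ⟨c, hc, -⟩ := exists_interior_of_eventually (p := 0) (P := fun _ => True) (by simp)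
  have hint : ∀ q ∈ interiorSquare, g q = g c := fun q hq => by
    refine apply_eq_of_eventually_eq (fun p hp => ?_) hq hc
    filter_upwards [hf.eventually_toTorus (isRegular_pt_of_mem_interior (s := s) hp)] with q h _
    simp only [g]
    rw [h, hlin]; abel
  have hall : g = fun _ => g c :=
    Continuous.ext_on dense_interiorSquare hgc continuous_const hint
  have h := (congrFun hall q).trans (congrFun hall p).symm
  simp only [g] at h
  rw [hlin, sub_eq_iff_eq_add.1 h]; abel

/-! ### Maps over the torus -/

/-- An interior point must go to the point with the same coordinates in some square. Being outside
each of the finitely many other squares is an open condition, so the square is locally constant on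
the interior; density gives the rest. -/
theorem exists_square_of_toTorus_eq {f : O.Surface → O'.Surface} (hf : Continuous f)
    (h : ∀ x, toTorus (f x) = toTorus x) (s : O.Sq) :
    ∃ s', ∀ p, f (pt s p) = pt s' p := by
  have hex : ∀ p ∈ interiorSquare, ∃ s', f (pt s p) = pt s' p := fun p hp => by
    obtain ⟨s', p', hp', heq⟩ := exists_eq_pt (f (pt s p))
    have h1 := h (pt s p)
    rw [heq, toTorus_pt_eq_iff, lowPt_of_ne hp', lowPt_of_ne (ne_one_of_mem_interior hp)] at h1
    exact ⟨s', h1 ▸ heq⟩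
  have : Nonempty O'.Sq := by
    obtain ⟨s', -⟩ := exists_eq_pt (f (corner s)); exact ⟨s'⟩
  choose! k hk using hex
  obtain ⟨c, hc, -⟩ := exists_interior_of_eventually (p := 0) (P := fun _ => True) (by simp)
  have hcont : Continuous fun q => f (pt s q) := hf.comp (continuous_pt s)
  have hconst : ∀ q ∈ interiorSquare, k q = k c := fun q hq => by
    refine apply_eq_of_eventually_eq (fun p hp => ?_) hq hc
    have hne : ∀ᶠ q in 𝓝 p, ∀ s' : O'.Sq, s' ≠ k p → f (pt s q) ≠ pt s' q := by
      rw [Filter.eventually_all]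
      intro s'
      by_cases hs' : s' = k p
      · simp [hs']
      have : f (pt s p) ≠ pt s' p := by
        rw [hk p hp, Ne, pt_eq_iff_of_mem_interior hp hp]
        exact fun h => hs' h.2.symm
      filter_upwards [(isOpen_ne_fun hcont (continuous_pt s')).mem_nhds this] with q hq _
        using hq
    filter_upwards [hne] with q h hq
    by_contra hne
    exact h _ hne (hk q hq)
  refine ⟨k c, fun p => ?_⟩
  refine congrFun (Continuous.ext_on dense_interiorSquare hcont (continuous_pt (k c))
    fun q hq => ?_) p
  rw [hk q hq, hconst q hq]

theorem exists_hom_of_toTorus_eq {f : O.Surface → O'.Surface} (hf : Continuous f)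
    (h : ∀ x, toTorus (f x) = toTorus x) : ∃ φ : Hom O O', ∀ x, f x = φ.map x := by
  choose k hk using exists_square_of_toTorus_eq hf h
  obtain ⟨m, hm, -⟩ := exists_interior_of_eventually (p := 0) (P := fun _ => True) (by simp)
  have hm0 := ne_zero_of_mem_interior hm 0
  have hm1 := ne_one_of_mem_interior hm 0
  refine ⟨⟨k, fun s => ?_, fun s => ?_⟩, fun x => ?_⟩
  · have h1 := congrArg f (pt_right s (m 0))
    rw [hk, hk, pt_right, pt_eq_iff_of_ne] at h1
    · rcases h1.2 with h | h
      · exact h.symm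
      · exact absurd (congrFun h.1 1) hm0
    all_goals intro i; fin_cases i <;> simp [hm1]
  · have h1 := congrArg f (pt_up s (m 0))
    rw [hk, hk, pt_up, pt_eq_iff_of_ne] at h1
    · rcases h1.2 with h | h
      · exact h.symm
      · exact absurd (congrFun h.1 0) hm0
    all_goals intro i; fin_cases i <;> simp [hm1]
  · obtain ⟨⟨s, p⟩, rfl⟩ := pt_surjective x
    exact hk s p

theorem Hom.map_pt (φ : Hom O O') (s : O.Sq) (p : Fin 2 → I) :
    φ.map (pt s p) = pt (φ.toFun s) p := rfl

theorem Hom.continuous_map (φ : Hom O O') : Continuous φ.map :=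
  continuous_of_forall_pt fun s => continuous_pt (φ.toFun s)

theorem Hom.toTorus_map (φ : Hom O O') (x : O.Surface) : toTorus (φ.map x) = toTorus x := by
  obtain ⟨⟨s, p⟩, rfl⟩ := pt_surjective x
  rfl

theorem Hom.isStepAffine_map (φ : Hom O O') : IsStepAffine φ.map 1 := by
  refine fun x => ⟨1, one_pos, ?_⟩
  rintro _ _ - ⟨s, p, q, rfl, rfl, rfl⟩
  rw [one_mulVec]
  exact step_pt (φ.toFun s) p q

/-- A continuous map with a two-sided inverse is a homeomorphism, as the surfaces are compact and
Hausdorff. -/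
def homeoOfInverse {f g : O.Surface → O.Surface} (hf : Continuous f)
    (hgf : Function.LeftInverse g f) (hfg : Function.RightInverse g f) : O.Surface ≃ₜ O.Surface :=
  Continuous.homeoOfEquivCompactToT2 (f := ⟨f, g, hgf, hfg⟩) hf

theorem forall_surface {P : O.Surface → Prop} (h : ∀ s a b, P (pt s ![a, b])) (x : O.Surface) :
    P x := by
  obtain ⟨⟨s, p⟩, rfl⟩ := pt_surjective x
  simp only
  rw [vec_eta p]
  exact h s _ _

/-! ### The quarter turn -/

section Rotation

variable {φ : Equiv.Perm O.Sq} (hr : ∀ s, φ (O.right s) = O.up (φ s))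
  (hu : ∀ s, O.right (φ (O.up s)) = φ s)

/-- The map which turns each square by a quarter turn. -/
def rotate (hr : ∀ s, φ (O.right s) = O.up (φ s)) (hu : ∀ s, O.right (φ (O.up s)) = φ s) :
    O.Surface → O.Surface :=
  lift (fun s a b => pt (φ s) ![unitInterval.symm b, a])
    (fun s t => by rw [pt_up, hr]) (fun s t => by simp [pt_right, hu])

/-- The inverse of the map `rotate`. -/
def rotateInv (hr : ∀ s, φ (O.right s) = O.up (φ s)) (hu : ∀ s, O.right (φ (O.up s)) = φ s) :
    O.Surface → O.Surface :=
  lift (fun s a b => pt (φ⁻¹ s) ![b, unitInterval.symm a])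
    (fun s t => by
      have : O.up (φ⁻¹ (O.right s)) = φ⁻¹ s := by
        rw [Equiv.Perm.eq_inv_iff_eq]
        apply O.right.injective
        rw [hu]; simp
      rw [unitInterval.symm_one, unitInterval.symm_zero, pt_up, this])
    (fun s t => by
      have : O.right (φ⁻¹ s) = φ⁻¹ (O.up s) := by
        rw [Equiv.Perm.eq_inv_iff_eq, hr]; simp
      rw [pt_right, this])

include hr hu in
theorem exists_affine_rotation : ∃ f : O.Surface ≃ₜ O.Surface,
    IsStepAffine f !![0, -1; 1, 0] := by
  have hc : Continuous (rotate hr hu) := continuous_of_forall_pt fun s =>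
    (continuous_pt (φ s)).comp (continuous_pi fun i => by
      fin_cases i
      · exact unitInterval.continuous_symm.comp (continuous_apply 1)
      · exact continuous_apply 0)
  refine ⟨homeoOfInverse (g := rotateInv hr hu) hc (forall_surface fun s a b => ?_)
    (forall_surface fun s a b => ?_), ?_⟩
  · simp [rotate, rotateInv]
  · simp [rotate, rotateInv]
  · refine fun x => ⟨1, one_pos, ?_⟩
    rintro _ _ - ⟨s, p, q, rfl, rfl, rfl⟩
    refine ⟨φ s, ![unitInterval.symm (p 1), p 0], ![unitInterval.symm (q 1), q 0], rfl, rfl, ?_⟩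
    ext i; fin_cases i <;> simp [toPlane, mulVec, vecHead, vecTail]
    ring

end Rotation

/-! ### The shear -/

section Shear

variable {φ : Equiv.Perm O.Sq} (hr : ∀ s, φ (O.right s) = O.right (φ s))
  (hu : ∀ s, φ (O.up s) = O.up (O.right (φ s)))

open Classical in
/-- The shear `(a, b) ↦ (a + b, b)` of the square `s`, as a map to the squares `φ s` and
`right (φ s)`. -/
def shearSq (φ : Equiv.Perm O.Sq) (s : O.Sq) (a b : I) : O.Surface :=
  if (a + b : ℝ) ≤ 1 then pt (φ s) ![Set.projIcc 0 1 zero_le_one (a + b), b]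
  else pt (O.right (φ s)) ![Set.projIcc 0 1 zero_le_one (a + b - 1), b]

theorem projIcc_eq {c : I} {t : ℝ} (h : (c : ℝ) = t) : Set.projIcc 0 1 zero_le_one t = c := by
  rw [← h, Set.projIcc_val]

theorem shearSq_of_le {s : O.Sq} {a b c : I} (h : (c : ℝ) = a + b) :
    shearSq φ s a b = pt (φ s) ![c, b] := by
  rw [shearSq, if_pos (h ▸ c.2.2), projIcc_eq h]

/-- On the diagonal a + b = 1 the other branch of `shearSq` applies, but it names the same point of
the common edge. Both formulas are therefore available on closed halves of the square. -/
theorem shearSq_of_ge {s : O.Sq} {a b c : I} (h : (c : ℝ) = a + b - 1) :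
    shearSq φ s a b = pt (O.right (φ s)) ![c, b] := by
  by_cases h1 : (a + b : ℝ) ≤ 1
  · have hc : c = 0 := Subtype.ext (le_antisymm (by rw [h]; simpa using h1) c.2.1)
    have h2 : (a + b : ℝ) = 1 := by rw [hc, Set.Icc.coe_zero] at h; linarith
    rw [shearSq_of_le (c := 1) (by rw [h2, Set.Icc.coe_one]), pt_right, hc]
  · rw [shearSq, if_neg h1, projIcc_eq h]

open Classical in
/-- The inverse of the shear on a square. -/
def shearInvSq (φ : Equiv.Perm O.Sq) (s : O.Sq) (a b : I) : O.Surface :=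
  if (b : ℝ) ≤ a then pt (φ⁻¹ s) ![Set.projIcc 0 1 zero_le_one (a - b), b]
  else pt (φ⁻¹ (O.right⁻¹ s)) ![Set.projIcc 0 1 zero_le_one (a - b + 1), b]

theorem shearInvSq_of_le {s : O.Sq} {a b c : I} (h : (c : ℝ) = a - b) :
    shearInvSq φ s a b = pt (φ⁻¹ s) ![c, b] := by
  rw [shearInvSq, if_pos (by have := c.2.1; linarith), projIcc_eq h]

include hr in
theorem shearInvSq_of_ge {s : O.Sq} {a b c : I} (h : (c : ℝ) = a - b + 1) :
    shearInvSq φ s a b = pt (φ⁻¹ (O.right⁻¹ s)) ![c, b] := by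
  by_cases h1 : (b : ℝ) ≤ a
  · have hc : c = 1 := Subtype.ext (le_antisymm c.2.2 (by rw [h, Set.Icc.coe_one]; linarith))
    have h2 : (a - b : ℝ) = 0 := by rw [hc, Set.Icc.coe_one] at h; linarith
    have h3 : O.right (φ⁻¹ (O.right⁻¹ s)) = φ⁻¹ s := by
      rw [Equiv.Perm.eq_inv_iff_eq, hr]; simp
    rw [shearInvSq_of_le (c := 0) (by rw [h2, Set.Icc.coe_zero]), hc, pt_right, h3]
  · rw [shearInvSq, if_neg h1, projIcc_eq h]

/-- The shear of the surface. -/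
def shear (hr : ∀ s, φ (O.right s) = O.right (φ s))
    (hu : ∀ s, φ (O.up s) = O.up (O.right (φ s))) : O.Surface → O.Surface :=
  lift (shearSq φ)
    (fun s t => by
      rw [shearSq_of_ge (c := t) (by simp), shearSq_of_le (c := t) (by simp), hr])
    (fun s t => by
      rw [shearSq_of_ge (c := t) (by simp), shearSq_of_le (c := t) (by simp), hu, pt_up])

/-- The inverse of the map `shear`. -/
def shearInv (hr : ∀ s, φ (O.right s) = O.right (φ s))
    (hu : ∀ s, φ (O.up s) = O.up (O.right (φ s))) : O.Surface → O.Surface :=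
  lift (shearInvSq φ)
    (fun s t => by
      rw [shearInvSq_of_le (c := unitInterval.symm t) (by simp),
        shearInvSq_of_ge hr (c := unitInterval.symm t) (by simp; ring)]
      simp)
    (fun s t => by
      have : O.up (φ⁻¹ (O.right⁻¹ s)) = φ⁻¹ (O.up s) := by
        rw [Equiv.Perm.eq_inv_iff_eq, hu]; simp
      rw [shearInvSq_of_ge hr (c := t) (by simp), shearInvSq_of_le (c := t) (by simp), pt_up,
        this])

theorem continuous_shearSq (φ : Equiv.Perm O.Sq) (s : O.Sq) :
    Continuous fun p : Fin 2 → I => shearSq φ s (p 0) (p 1) := by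
  have hproj : ∀ t : O.Sq, ∀ h : (Fin 2 → I) → ℝ, Continuous h → Continuous fun p =>
      (pt t ![Set.projIcc 0 1 zero_le_one (h p), p 1] : O.Surface) := fun t h hh =>
    (continuous_pt t).comp (continuous_pi fun i => by
      fin_cases i
      · exact (continuous_projIcc (h := zero_le_one)).comp hh
      · exact continuous_apply 1)
  refine Continuous.if_le (hproj _ _ (by fun_prop)) (hproj _ _ (by fun_prop)) (by fun_prop)
    continuous_const fun p hp => ?_
  rw [projIcc_eq (c := 1) (by simp [hp]), projIcc_eq (c := 0) (by simp [hp]), pt_right]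

/-- Within each closed half of a square cut by a + b = 1 the shear lands in a single square and is
linear there. It remains to see that p and a nearby q share a half. -/
theorem isStepAffine_shear : IsStepAffine (shear hr hu) !![1, 1; 0, 1] := by
  intro x
  refine forall_step_of_eventually
    (R := fun y v => Step (shear hr hu x) (shear hr hu y) (!![1, 1; 0, 1] *ᵥ v)) ?_
  rintro s p rfl
  have key : ∀ q : Fin 2 → I, ((p 0 + p 1 : ℝ) ≤ 1 ∧ (q 0 + q 1 : ℝ) ≤ 1) ∨
      (1 ≤ (p 0 + p 1 : ℝ) ∧ 1 ≤ (q 0 + q 1 : ℝ)) →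
      Step (shear hr hu (pt s p)) (shear hr hu (pt s q))
        (!![1, 1; 0, 1] *ᵥ (toPlane q - toPlane p)) := by
    intro q h
    have hp0 := (p 0).2; have hp1 := (p 1).2; have hq0 := (q 0).2; have hq1 := (q 1).2
    rcases h with ⟨h1, h2⟩ | ⟨h1, h2⟩
    · refine ⟨φ s, ![⟨p 0 + p 1, add_nonneg hp0.1 hp1.1, h1⟩, p 1],
        ![⟨q 0 + q 1, add_nonneg hq0.1 hq1.1, h2⟩, q 1],
        (shearSq_of_le rfl).symm, (shearSq_of_le rfl).symm, ?_⟩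
      ext i; fin_cases i <;> simp [toPlane, mulVec, vecHead, vecTail]
    · refine ⟨O.right (φ s), ![⟨p 0 + p 1 - 1, by linarith, by linarith [hp0.2, hp1.2]⟩, p 1],
        ![⟨q 0 + q 1 - 1, by linarith, by linarith [hq0.2, hq1.2]⟩, q 1],
        (shearSq_of_ge rfl).symm, (shearSq_of_ge rfl).symm, ?_⟩
      ext i; fin_cases i <;> simp [toPlane, mulVec, vecHead, vecTail]
  have hc : Continuous fun q : Fin 2 → I => (q 0 + q 1 : ℝ) := by fun_prop
  rcases lt_trichotomy (p 0 + p 1 : ℝ) 1 with h | h | h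
  · filter_upwards [hc.continuousAt.eventually_lt_const h] with q hq
    exact key q (.inl ⟨h.le, hq.le⟩)
  -- A point on the diagonal belongs to both halves, so whichever half contains q can be used.
  · refine .of_forall fun q => key q ?_
    rcases le_total (q 0 + q 1 : ℝ) 1 with hq | hq
    · exact .inl ⟨h.le, hq⟩
    · exact .inr ⟨h.ge, hq⟩
  · filter_upwards [hc.continuousAt.eventually_const_lt h] with q hq
    exact key q (.inr ⟨h.le, hq.le⟩)

include hr hu in
theorem exists_affine_shear : ∃ f : O.Surface ≃ₜ O.Surface,
    IsStepAffine f !![1, 1; 0, 1] := by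
  have hc : Continuous (shear hr hu) := continuous_of_forall_pt fun s =>
    continuous_shearSq φ s
  refine ⟨homeoOfInverse (g := shearInv hr hu) hc (forall_surface fun s a b => ?_)
    (forall_surface fun s a b => ?_), isStepAffine_shear hr hu⟩
  · change shearInv hr hu (shearSq φ s a b) = _
    have ha := a.2; have hb := b.2
    rcases le_total (a + b : ℝ) 1 with h | h
    · rw [shearSq_of_le (c := ⟨a + b, add_nonneg ha.1 hb.1, h⟩) rfl]
      change shearInvSq φ _ _ _ = _
      rw [shearInvSq_of_le (c := a) (by simp)]
      simp
    · rw [shearSq_of_ge (c := ⟨a + b - 1, by linarith, by linarith [ha.2, hb.2]⟩) rfl]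
      change shearInvSq φ _ _ _ = _
      rw [shearInvSq_of_ge hr (c := a) (by simp; ring)]
      simp
  · change shear hr hu (shearInvSq φ s a b) = _
    have ha := a.2; have hb := b.2
    rcases le_total (b : ℝ) a with h | h
    · rw [shearInvSq_of_le (c := ⟨a - b, by linarith, by linarith [ha.2, hb.1]⟩) rfl]
      change shearSq φ _ _ _ = _
      rw [shearSq_of_le (c := a) (by simp)]
      simp
    · rw [shearInvSq_of_ge hr (c := ⟨a - b + 1, by linarith [ha.1, hb.2], by linarith⟩) rfl]
      change shearSq φ _ _ _ = _
      rw [shearSq_of_ge (c := a) (by simp; ring)]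
      simp

end Shear

end Origami

/-! ### The group `PSL(2, ℤ/3)` -/

/-- Entrywise form of the factorisation of each element of SL₂(ℤ/3) as upper · lower · upper · lower
unipotent. -/
theorem exists_word_zmod_three : ∀ a b c d : ZMod 3, a * d - b * c = 1 → ∃ i j k m : ZMod 3,
    a = (1 + i * j) * (1 + k * m) + i * m ∧ b = (1 + i * j) * k + i ∧
      c = j * (1 + k * m) + m ∧ d = j * k + 1 := by
  decide

/-- The upper unipotent matrices over `ℤ/3`. -/
def upperZ3 (x : ZMod 3) : SL(2, ZMod 3) := ⟨!![1, x; 0, 1], by simp⟩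

/-- The lower unipotent matrices over `ℤ/3`. -/
def lowerZ3 (x : ZMod 3) : SL(2, ZMod 3) := ⟨!![1, 0; x, 1], by simp⟩

theorem coe_upperZ3 (x : ZMod 3) : (upperZ3 x).1 = !![1, x; 0, 1] := rfl

theorem coe_lowerZ3 (x : ZMod 3) : (lowerZ3 x).1 = !![1, 0; x, 1] := rfl

theorem upperZ3_zero : upperZ3 0 = 1 := Subtype.ext one_fin_two.symm

theorem lowerZ3_zero : lowerZ3 0 = 1 := Subtype.ext one_fin_two.symm

theorem upperZ3_mul (x y : ZMod 3) : upperZ3 x * upperZ3 y = upperZ3 (x + y) :=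
  Subtype.ext (by simp [Matrix.SpecialLinearGroup.coe_mul, coe_upperZ3, add_comm])

theorem lowerZ3_mul (x y : ZMod 3) : lowerZ3 x * lowerZ3 y = lowerZ3 (x + y) :=
  Subtype.ext (by simp [Matrix.SpecialLinearGroup.coe_mul, coe_lowerZ3])

theorem upperZ3_pow (x : ZMod 3) (n : ℕ) : upperZ3 x ^ n = upperZ3 (n * x) := by
  induction n with
  | zero => rw [Nat.cast_zero, zero_mul, pow_zero, upperZ3_zero]
  | succ n ih => rw [pow_succ, ih, upperZ3_mul, Nat.cast_succ, add_mul, one_mul]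

theorem lowerZ3_pow (x : ZMod 3) (n : ℕ) : lowerZ3 x ^ n = lowerZ3 (n * x) := by
  induction n with
  | zero => rw [Nat.cast_zero, zero_mul, pow_zero, lowerZ3_zero]
  | succ n ih => rw [pow_succ, ih, lowerZ3_mul, Nat.cast_succ, add_mul, one_mul]

theorem two_mul_val_mul_two : ∀ x : ZMod 3, (((2 * x).val : ℕ) : ZMod 3) * 2 = x := by
  decide

/-- Since 2 · 2 = 1 modulo 3, powers of the two given elements exhaust both unipotent subgroups, and
products of four unipotents give everything. The parameter 2 is that of T² and L². -/
theorem eq_top_of_unipotent_mem {H : Subgroup SL(2, ZMod 3)} (hu : upperZ3 2 ∈ H)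
    (hl : lowerZ3 2 ∈ H) : H = ⊤ := by
  have hu' : ∀ x, upperZ3 x ∈ H := fun x => by
    have := H.pow_mem hu (2 * x).val
    rwa [upperZ3_pow, two_mul_val_mul_two] at this
  have hl' : ∀ x, lowerZ3 x ∈ H := fun x => by
    have := H.pow_mem hl (2 * x).val
    rwa [lowerZ3_pow, two_mul_val_mul_two] at this
  rw [eq_top_iff]
  intro g _
  have hdet := g.det_coe
  rw [det_fin_two] at hdet
  obtain ⟨i, j, k, m, h1, h2, h3, h4⟩ := exists_word_zmod_three _ _ _ _ hdet
  have : g = upperZ3 i * lowerZ3 j * upperZ3 k * lowerZ3 m := by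
    apply Subtype.ext
    rw [eta_fin_two g.1, h1, h2, h3, h4]
    simp only [Matrix.SpecialLinearGroup.coe_mul, coe_upperZ3, coe_lowerZ3, mul_fin_two]
    ring_nf
  rw [this]
  exact H.mul_mem (H.mul_mem (H.mul_mem (hu' i) (hl' j)) (hu' k)) (hl' m)

theorem mem_center_zmod_three_iff {g : SL(2, ZMod 3)} :
    g ∈ Subgroup.center SL(2, ZMod 3) ↔ g = 1 ∨ g = -1 := by
  constructor
  · rw [Matrix.SpecialLinearGroup.mem_center_iff]
    rintro ⟨r, hr, h⟩
    rw [Fintype.card_fin, sq_eq_one_iff] at hr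
    rcases hr with rfl | rfl
    · left; ext i j; rw [← h]; simp
    · right; ext i j; rw [← h]; fin_cases i <;> fin_cases j <;> simp
  · rintro (rfl | rfl)
    · exact one_mem _
    · rw [Subgroup.mem_center_iff]; intro h; simp

theorem card_SL_zmod_three : Nat.card SL(2, ZMod 3) = 24 := by
  rw [Nat.card_eq_fintype_card]
  decide +kernel

theorem card_PSL_zmod_three : Nat.card PSL(2, ZMod 3) = 12 := by
  have h1 := Subgroup.card_eq_card_quotient_mul_card_subgroup (Subgroup.center SL(2, ZMod 3))
  have h2 : Nat.card (Subgroup.center SL(2, ZMod 3)) = 2 := by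
    have : ((Subgroup.center SL(2, ZMod 3) : Set SL(2, ZMod 3))) = {1, -1} := by
      ext g; exact mem_center_zmod_three_iff
    rw [← SetLike.coe_sort_coe, Nat.card_coe_set_eq, this, Set.ncard_pair]
    intro h
    have := congrArg (fun g : SL(2, ZMod 3) => g.1 0 0) h
    simp at this
    revert this; decide
  rw [h2, card_SL_zmod_three] at h1
  change Nat.card (SL(2, ZMod 3) ⧸ Subgroup.center SL(2, ZMod 3)) = 12
  omega

/-! ### Reduction modulo 3 -/

/-- Reduction modulo 3, as a map to `PSL(2, ℤ/3)`. -/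
def redSL : SL(2, ℤ) →* PSL(2, ZMod 3) :=
  (QuotientGroup.mk' (Subgroup.center SL(2, ZMod 3))).comp
    (Matrix.SpecialLinearGroup.map (Int.castRingHom (ZMod 3)))

theorem eq_one_or_neg_one_of_mem_center {g : SL(2, ℤ)} (h : g ∈ Subgroup.center SL(2, ℤ)) :
    g = 1 ∨ g = -1 := by
  rw [Matrix.SpecialLinearGroup.mem_center_iff] at h
  obtain ⟨r, hr, h⟩ := h
  rw [Fintype.card_fin, sq_eq_one_iff] at hr
  rcases hr with rfl | rfl
  · left; ext i j; rw [← h]; simp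
  · right; ext i j; rw [← h]; fin_cases i <;> fin_cases j <;> simp

theorem redSL_neg (g : SL(2, ℤ)) : redSL (-g) = redSL g := by
  have : redSL (-1) = 1 := by
    refine (QuotientGroup.eq_one_iff _).2 (mem_center_zmod_three_iff.2 (.inr ?_))
    ext i j; fin_cases i <;> fin_cases j <;> simp
  rw [← neg_one_mul, map_mul, this, one_mul]

/-- Reduction modulo 3 on `PSL(2, ℤ)`. -/
def redPSL : PSL(2, ℤ) →* PSL(2, ZMod 3) :=
  QuotientGroup.lift _ redSL fun g hg => by
    rcases eq_one_or_neg_one_of_mem_center hg with rfl | rfl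
    · exact map_one _
    · exact (redSL_neg 1).trans (map_one _)

theorem mk_neg_PSL (g : SL(2, ℤ)) : (QuotientGroup.mk (-g) : PSL(2, ℤ)) = QuotientGroup.mk g := by
  rw [QuotientGroup.eq]
  have : (-g)⁻¹ * g = -1 := by
    rw [inv_mul_eq_iff_eq_mul]; simp
  rw [this, Subgroup.mem_center_iff]
  intro h; simp

/-- Chinese remainder theorem: Γ₂ ∩ Γ₃ ⊆ Γ₆, as 2 and 3 are coprime. -/
theorem mem_Gamma_six {g : SL(2, ℤ)} (h2 : g ∈ CongruenceSubgroup.Gamma 2)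
    (h3 : Matrix.SpecialLinearGroup.map (Int.castRingHom (ZMod 3)) g = 1) :
    g ∈ CongruenceSubgroup.Gamma 6 := by
  have h3 : g ∈ CongruenceSubgroup.Gamma 3 := h3
  rw [CongruenceSubgroup.Gamma_mem] at *
  have key : ∀ N : ℕ, ∀ x y : ℤ, (x : ZMod N) = (y : ZMod N) ↔ (N : ℤ) ∣ y - x := fun N x y =>
    ZMod.intCast_eq_intCast_iff_dvd_sub x y N
  have k1 : ∀ N : ℕ, ∀ x : ℤ, (x : ZMod N) = 1 ↔ (N : ℤ) ∣ 1 - x := fun N x => by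
    rw [← key, Int.cast_one]
  have k0 : ∀ N : ℕ, ∀ x : ℤ, (x : ZMod N) = 0 ↔ (N : ℤ) ∣ 0 - x := fun N x => by
    rw [← key, Int.cast_zero]
  simp only [k0, k1] at *
  push_cast at *
  refine ⟨?_, ?_, ?_, ?_⟩ <;> omega

/-- Reduction modulo 3 on `PΓ₂`. -/
def redPGamma : PGamma 2 →* PSL(2, ZMod 3) := redPSL.comp (PGamma 2).subtype

theorem map_matT_sq :
    Matrix.SpecialLinearGroup.map (Int.castRingHom (ZMod 3)) (matT ^ 2) = upperZ3 2 := by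
  rw [pow_two, map_mul, show Matrix.SpecialLinearGroup.map (Int.castRingHom (ZMod 3)) matT =
    upperZ3 1 by ext i j; fin_cases i <;> fin_cases j <;> rfl, upperZ3_mul]
  rfl

theorem map_matL_sq :
    Matrix.SpecialLinearGroup.map (Int.castRingHom (ZMod 3)) (matL ^ 2) = lowerZ3 2 := by
  rw [pow_two, map_mul, show Matrix.SpecialLinearGroup.map (Int.castRingHom (ZMod 3)) matL =
    lowerZ3 1 by ext i j; fin_cases i <;> fin_cases j <;> rfl, lowerZ3_mul]
  rfl

theorem redPGamma_surjective : Function.Surjective redPGamma := by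
  rw [← MonoidHom.range_eq_top]
  have h : redPGamma.range.comap (QuotientGroup.mk' (Subgroup.center SL(2, ZMod 3))) = ⊤ := by
    refine eq_top_of_unipotent_mem ?_ ?_
    · exact ⟨⟨_, Subgroup.mem_map_of_mem _ matT_sq_mem⟩, congrArg QuotientGroup.mk map_matT_sq⟩
    · exact ⟨⟨_, Subgroup.mem_map_of_mem _ matL_sq_mem⟩, congrArg QuotientGroup.mk map_matL_sq⟩
  exact Subgroup.comap_injective (QuotientGroup.mk'_surjective _) (h.trans (Subgroup.comap_top _).symm)

/-- An element of the kernel lifts to g in Γ₂ with g ≡ ±1 modulo 3. In the negative case g is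
replaced by -g, which has the same class and is still in Γ₂ because -1 = 1 modulo 2. -/
theorem ker_redPGamma : redPGamma.ker = (PGamma 6).subgroupOf (PGamma 2) := by
  ext ⟨x, hx⟩
  rw [MonoidHom.mem_ker, Subgroup.mem_subgroupOf]
  constructor
  · obtain ⟨g, hg, rfl⟩ := hx
    intro h
    have h : redSL g = 1 := h
    rcases mem_center_zmod_three_iff.1 ((QuotientGroup.eq_one_iff _).1 h) with h1 | h1
    · exact Subgroup.mem_map_of_mem _ (mem_Gamma_six hg h1)
    · refine ⟨-g, mem_Gamma_six ?_ ?_, mk_neg_PSL g⟩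
      · rw [SetLike.mem_coe, CongruenceSubgroup.Gamma_mem] at hg
        rw [CongruenceSubgroup.Gamma_mem]
        simpa [ZMod.neg_eq_self_mod_two] using hg
      · rw [← neg_eq_iff_eq_neg] at h1
        rw [← h1]
        ext i j; simp
  · rintro ⟨g, hg, h⟩
    obtain rfl : QuotientGroup.mk g = x := h
    change QuotientGroup.mk (Matrix.SpecialLinearGroup.map (Int.castRingHom (ZMod 3)) g) = _
    have : Matrix.SpecialLinearGroup.map (Int.castRingHom (ZMod 3)) g = 1 := by
      rw [SetLike.mem_coe, CongruenceSubgroup.Gamma_mem'] at hg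
      have h63 : (3 : ℕ) ∣ 6 := by norm_num
      have := congrArg (Matrix.SpecialLinearGroup.map (ZMod.castHom h63 (ZMod 3))) hg
      rw [map_one] at this
      rw [← this]
      ext i j; simp
    rw [this]
    rfl

/-- The isomorphism `PΓ₂ / PΓ₆ ≅ PSL(2, ℤ/3)`. -/
def quotEquiv : PGammaQuot ≃* PSL(2, ZMod 3) :=
  (QuotientGroup.quotientMulEquivOfEq ker_redPGamma.symm).trans
    (QuotientGroup.quotientKerEquivOfSurjective redPGamma redPGamma_surjective)

theorem quotEquiv_clT2 : quotEquiv clT2 = QuotientGroup.mk (upperZ3 2) :=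
  congrArg QuotientGroup.mk map_matT_sq

theorem quotEquiv_clL2 : quotEquiv clL2 = QuotientGroup.mk (lowerZ3 2) :=
  congrArg QuotientGroup.mk map_matL_sq

theorem card_PGammaQuot : Nat.card PGammaQuot = 12 := by
  rw [Nat.card_congr quotEquiv.toEquiv, card_PSL_zmod_three]

/-! ### Orders of the generators and generation -/

theorem clT2_pow_three : clT2 ^ 3 = 1 := by
  apply quotEquiv.injective
  rw [map_pow, quotEquiv_clT2, map_one, ← QuotientGroup.mk_pow, upperZ3_pow,
    QuotientGroup.eq_one_iff, mem_center_zmod_three_iff]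
  exact .inl (by ext i j; fin_cases i <;> fin_cases j <;> decide)

theorem clL2_pow_three : clL2 ^ 3 = 1 := by
  apply quotEquiv.injective
  rw [map_pow, quotEquiv_clL2, map_one, ← QuotientGroup.mk_pow, lowerZ3_pow,
    QuotientGroup.eq_one_iff, mem_center_zmod_three_iff]
  exact .inl (by ext i j; fin_cases i <;> fin_cases j <;> decide)

/-- The matrix modulo 3 has trace 1 + 2·2 + 1 = 0 and determinant 1, so its square is -1, which is
trivial in PSL₂. -/
theorem clT2_mul_clL2_sq : (clT2 * clL2) ^ 2 = 1 := by
  apply quotEquiv.injective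
  rw [map_pow, map_mul, quotEquiv_clT2, quotEquiv_clL2, map_one, ← QuotientGroup.mk_mul,
    ← QuotientGroup.mk_pow, QuotientGroup.eq_one_iff, mem_center_zmod_three_iff]
  right
  apply Subtype.ext
  simp only [pow_two, Matrix.SpecialLinearGroup.coe_mul, coe_upperZ3, coe_lowerZ3, mul_fin_two,
    Matrix.SpecialLinearGroup.coe_neg, Matrix.SpecialLinearGroup.coe_one]
  decide

theorem clT2_ne_one : clT2 ≠ 1 := by
  intro h
  have := congrArg quotEquiv h
  rw [quotEquiv_clT2, map_one, QuotientGroup.eq_one_iff, mem_center_zmod_three_iff] at this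
  rcases this with h | h <;>
  · have := congrArg (fun g : SL(2, ZMod 3) => g.1 0 1) h
    simp [upperZ3] at this
    revert this; decide

theorem clL2_ne_one : clL2 ≠ 1 := by
  intro h
  have := congrArg quotEquiv h
  rw [quotEquiv_clL2, map_one, QuotientGroup.eq_one_iff, mem_center_zmod_three_iff] at this
  rcases this with h | h <;>
  · have := congrArg (fun g : SL(2, ZMod 3) => g.1 1 0) h
    simp [lowerZ3] at this
    revert this; decide

theorem closure_clT2_clL2 : Subgroup.closure {clT2, clL2} = ⊤ := by
  have h : ((Subgroup.closure {clT2, clL2}).map quotEquiv.toMonoidHom).comap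
      (QuotientGroup.mk' (Subgroup.center SL(2, ZMod 3))) = ⊤ := by
    refine eq_top_of_unipotent_mem ?_ ?_
    · exact ⟨clT2, Subgroup.subset_closure (by simp), quotEquiv_clT2⟩
    · exact ⟨clL2, Subgroup.subset_closure (by simp), quotEquiv_clL2⟩
  have h := Subgroup.comap_injective (QuotientGroup.mk'_surjective _)
    (h.trans (Subgroup.comap_top _).symm)
  rw [eq_top_iff]
  intro x _
  have hx : quotEquiv x ∈ (Subgroup.closure {clT2, clL2}).map quotEquiv.toMonoidHom := by
    rw [h]; trivial
  obtain ⟨y, hy, hxy⟩ := hx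
  exact quotEquiv.injective hxy ▸ hy

namespace Origami

variable {O : Origami}

/-! ### Vertices, edges and faces -/

theorem vertices_eq : O.vertices = Set.range corner := by
  ext x
  constructor
  · rintro ⟨s, p, hp, rfl⟩
    refine ⟨lowSq s p, ?_⟩
    rw [← pt_low s p, corner]
    congr 1
    ext i
    rcases hp i with h | h <;> simp [lowPt, h]
  · rintro ⟨s, rfl⟩
    exact ⟨s, 0, fun i => .inl rfl, rfl⟩

theorem card_faces : O.faces.ncard = Nat.card O.Sq := by
  have h : O.faces = Set.range fun s : O.Sq => Set.range (pt s) := by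
    ext F; exact exists_congr fun s => eq_comm
  rw [h, ← Nat.card_coe_set_eq]
  refine Nat.card_range_of_injective fun s s' hs => ?_
  obtain ⟨m, hm, -⟩ := exists_interior_of_eventually (p := 0) (P := fun _ => True) (by simp)
  have : pt s m ∈ Set.range (pt s') := by
    rw [← show Set.range (pt s) = Set.range (pt s') from hs]; exact ⟨m, rfl⟩
  obtain ⟨q, hq⟩ := this
  have hq2 := pt_eq_iff.1 hq
  rw [lowPt_of_ne (ne_one_of_mem_interior hm)] at hq2
  have : q = m := by
    ext i
    rcases low_eq_low_iff.1 (show low (q i) = low (m i) by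
      rw [low_of_ne (ne_one_of_mem_interior hm i)]; exact congrFun hq2.1 i) with h | h | h
    · rw [h]
    · exact absurd h.2 (ne_one_of_mem_interior hm i)
    · exact absurd h.2 (ne_zero_of_mem_interior hm i)
  rw [this] at hq
  exact ((pt_eq_iff_of_mem_interior hm hm).1 hq).2.symm

/-- The left edge (for `i = 0`) or the lower edge (for `i = 1`) of a square. -/
def lowEdge (z : O.Sq × Fin 2) : Set O.Surface := pt z.1 '' {p | p z.2 = 0}

theorem image_right_edge (s : O.Sq) : pt s '' {p | p 0 = 1} = lowEdge (O.right s, 0) := by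
  ext x
  constructor
  · rintro ⟨p, hp, rfl⟩
    exact ⟨![0, p 1], rfl, by rw [← pt_right, ← show p 0 = 1 from hp, ← vec_eta]⟩
  · rintro ⟨p, hp, rfl⟩
    exact ⟨![1, p 1], rfl, by rw [pt_right, ← show p 0 = 0 from hp, ← vec_eta]⟩

theorem image_upper_edge (s : O.Sq) : pt s '' {p | p 1 = 1} = lowEdge (O.up s, 1) := by
  ext x
  constructor
  · rintro ⟨p, hp, rfl⟩
    exact ⟨![p 0, 0], rfl, by rw [← pt_up, ← show p 1 = 1 from hp, ← vec_eta]⟩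
  · rintro ⟨p, hp, rfl⟩
    exact ⟨![p 0, 1], rfl, by rw [pt_up, ← show p 1 = 0 from hp, ← vec_eta]⟩

theorem edges_eq : O.edges = Set.range lowEdge := by
  ext e
  constructor
  · rintro ⟨s, i, c, rfl | rfl, rfl⟩
    · exact ⟨(s, i), rfl⟩
    · fin_cases i
      · exact ⟨_, (image_right_edge s).symm⟩
      · exact ⟨_, (image_upper_edge s).symm⟩
  · rintro ⟨⟨s, i⟩, rfl⟩
    exact ⟨s, i, 0, .inl rfl, rfl⟩

/-- A point of an open edge, away from the vertices, lies on only one left or lower edge; `p` is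
chosen to be such a point. -/
theorem lowEdge_injective : Function.Injective (lowEdge (O := O)) := by
  obtain ⟨m, hm, -⟩ := exists_interior_of_eventually (p := 0) (P := fun _ => True) (by simp)
  have hm0 := ne_zero_of_mem_interior hm 0
  have hm1 := ne_one_of_mem_interior hm 0
  rintro ⟨s, i⟩ ⟨s', i'⟩ h
  let p : Fin 2 → I := fun j => if j = i then 0 else m 0
  have hp1 : ∀ j, p j ≠ 1 := fun j => by
    simp only [p]; split_ifs <;> simp [hm1]
  have hp : pt s p ∈ lowEdge (s', i') := by rw [← h]; exact ⟨p, by simp [p], rfl⟩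
  obtain ⟨q, hq, hqp⟩ := hp
  have hq : q i' = 0 := hq
  have h2 := pt_eq_iff.1 hqp
  rw [lowPt_of_ne hp1, lowSq_of_ne hp1] at h2
  obtain ⟨h3, h4⟩ := h2
  have hi : i' = i := by
    by_contra hne
    have := congrFun h3 i'
    simp only [lowPt, hq, low_zero, p, if_neg hne] at this
    exact hm0 this.symm
  subst hi
  have hqp : q = p := by
    ext j
    have := congrFun h3 j
    by_cases hj : j = i'
    · simp [p, hj, hq]
    · simp only [lowPt, p, if_neg hj] at this ⊢
      by_cases hq1 : q j = 1
      · rw [hq1, low_one] at this; exact absurd this.symm hm0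
      · rw [low_of_ne hq1] at this; rw [this]
  rw [hqp, lowSq_of_ne hp1] at h4
  rcases h4 with h4 | ⟨h4, -⟩
  · exact congrArg (·, i') h4.symm
  · exfalso
    have h5 : ∃ j : Fin 2, j ≠ i' := exists_ne i'
    obtain ⟨j, hj⟩ := h5
    have := congrFun h4 j
    simp only [lowPt_of_ne hp1, p, if_neg hj] at this
    exact hm0 this

theorem card_edges : O.edges.ncard = 2 * Nat.card O.Sq := by
  rw [edges_eq, ← Nat.card_coe_set_eq, Nat.card_range_of_injective lowEdge_injective,
    Nat.card_prod, Nat.card_fin, mul_comm]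

/-- Each square owns its left and its lower edge, so E = 2F. -/
theorem eulerChar_eq : O.eulerChar = (O.vertices.ncard : ℤ) - Nat.card O.Sq := by
  rw [eulerChar, card_edges, card_faces]; push_cast; ring

end Origami

/-! ### Relations in `PΓ₂ / PΓ₆` -/

theorem clT2_inv : clT2⁻¹ = clT2 * clT2 :=
  inv_eq_of_mul_eq_one_left (by rw [← clT2_pow_three, pow_succ, pow_two])

theorem clL2_inv : clL2⁻¹ = clL2 * clL2 :=
  inv_eq_of_mul_eq_one_left (by rw [← clL2_pow_three, pow_succ, pow_two])

theorem clT2_mul_clL2 : clT2 * clL2 = clL2⁻¹ * clT2⁻¹ := by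
  rw [← _root_.mul_inv_rev, eq_inv_iff_mul_eq_one, ← pow_two, clT2_mul_clL2_sq]

theorem clL2_mul_clT2 : clL2 * clT2 = clT2⁻¹ * clL2⁻¹ := by
  rw [eq_inv_mul_iff_mul_eq, ← mul_assoc, clT2_mul_clL2]; group

theorem clT2_mul_clL2_inv_pow_three : (clT2 * clL2⁻¹) ^ 3 = 1 := by
  have h : clL2⁻¹ * clT2 = clL2 * clT2⁻¹ * clL2⁻¹ := by
    rw [clL2_inv, mul_assoc, clL2_mul_clT2, mul_assoc, ← clL2_inv]
  calc
    _ = clT2 * (clL2⁻¹ * clT2) * (clL2⁻¹ * clT2) * clL2⁻¹ := by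
      simp only [pow_succ, pow_zero, one_mul, mul_assoc]
    _ = clT2 * clL2 * (clT2⁻¹ * clT2⁻¹) * (clL2⁻¹ * clL2⁻¹) := by rw [h]; group
    _ = clT2 * clL2 * (clT2 * clL2) := by
      rw [← _root_.mul_inv_rev, ← clT2_inv, inv_inv, ← _root_.mul_inv_rev, ← clL2_inv, inv_inv, mul_assoc]
    _ = 1 := by rw [← pow_two, clT2_mul_clL2_sq]

theorem clT2_mul_clL2_inv_ne_one : clT2 * clL2⁻¹ ≠ 1 := fun h => by
  have h1 : clT2 = clL2 := mul_inv_eq_one.1 h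
  apply clT2_ne_one
  have h2 := clT2_mul_clL2_sq
  rw [← h1] at h2
  calc
    _ = (clT2 * clT2) ^ 2 * (clT2 ^ 3)⁻¹ := by
      simp only [pow_succ, pow_zero, one_mul]; group
    _ = 1 := by rw [h2, clT2_pow_three, inv_one, one_mul]

/-! ### The vertices of `X` -/

/-- The effect on the first component of the label of going once around the lower left corner of a
square `(A, h)`. -/
def cornerGen : Fin 4 → PGammaQuot
  | 0 => (clT2 * clL2⁻¹)⁻¹
  | 1 => clT2
  | 2 => 1
  | 3 => clL2⁻¹

/-- The square with label `(A, h)`. -/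
def sqX (A : PGammaQuot) (h : Fin 4) : origamiX.Sq := (A, h)

theorem sqX_inj {A A' : PGammaQuot} {h h' : Fin 4} : sqX A h = sqX A' h' ↔ A = A' ∧ h = h' :=
  Prod.mk_inj

theorem exists_eq_sqX (s : origamiX.Sq) : ∃ A h, s = sqX A h := ⟨s.1, s.2, rfl⟩

/-- With t and l the two classes, the four commutators multiply by (t l⁻¹)², t⁻², 1 and l². Since t,
l and t l⁻¹ have cube 1, they simplify to the values of `cornerGen`. -/
theorem comm_origamiX (A : PGammaQuot) (h : Fin 4) :
    origamiX.comm (sqX A h) = sqX (A * cornerGen h) h := by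
  match h with
  | 0 =>
    change (A * clT2 * clL2⁻¹ * clT2 * clL2⁻¹, (0 : Fin 4)) = (A * (clT2 * clL2⁻¹)⁻¹, 0)
    rw [show (clT2 * clL2⁻¹)⁻¹ = (clT2 * clL2⁻¹) ^ 2 from
      inv_eq_of_mul_eq_one_left (by rw [← pow_succ, clT2_mul_clL2_inv_pow_three])]
    simp only [pow_two, mul_assoc]
  | 1 =>
    change (A * clT2⁻¹ * clT2⁻¹, (1 : Fin 4)) = (A * clT2, 1)
    rw [mul_assoc, ← _root_.mul_inv_rev, ← clT2_inv, inv_inv]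
  | 2 =>
    change (A * clL2⁻¹ * clL2 * clL2⁻¹ * clL2, (2 : Fin 4)) = (A * 1, 2)
    simp
  | 3 =>
    change (A * clL2 * clL2, (3 : Fin 4)) = (A * clL2⁻¹, 3)
    rw [mul_assoc, ← clL2_inv]

theorem orderOf_cornerGen {h : Fin 4} (hh : h ≠ 2) : orderOf (cornerGen h) = 3 := by
  match h with
  | 0 =>
    exact (orderOf_inv _).trans
      (orderOf_eq_prime clT2_mul_clL2_inv_pow_three clT2_mul_clL2_inv_ne_one)
  | 1 => exact orderOf_eq_prime clT2_pow_three clT2_ne_one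
  | 2 => exact absurd rfl hh
  | 3 => exact (orderOf_inv _).trans (orderOf_eq_prime clL2_pow_three clL2_ne_one)

theorem cornerGen_ne_one {h : Fin 4} (hh : h ≠ 2) : cornerGen h ≠ 1 := fun h1 => by
  have := orderOf_cornerGen hh
  rw [h1, orderOf_one] at this
  omega

theorem comm_origamiX_pow (A : PGammaQuot) (h : Fin 4) (n : ℕ) :
    (origamiX.comm ^ n) (sqX A h) = sqX (A * cornerGen h ^ n) h := by
  induction n with
  | zero => rw [pow_zero, pow_zero, mul_one]; rfl
  | succ n ih =>
    rw [pow_succ', Equiv.Perm.mul_apply, ih, comm_origamiX, mul_assoc, ← pow_succ]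

theorem sameCycle_origamiX {A A' : PGammaQuot} {h h' : Fin 4} :
    origamiX.comm.SameCycle (sqX A h) (sqX A' h') ↔
      h = h' ∧ A⁻¹ * A' ∈ Subgroup.zpowers (cornerGen h) := by
  constructor
  · intro H
    obtain ⟨n, -, hn⟩ := H.exists_pow_eq'
    rw [comm_origamiX_pow] at hn
    obtain ⟨rfl, rfl⟩ := sqX_inj.1 hn
    exact ⟨rfl, by simp⟩
  · rintro ⟨rfl, H⟩
    obtain ⟨n, hn⟩ := (isOfFinOrder_of_finite _).mem_powers_iff_mem_zpowers.2 H
    refine ⟨n, ?_⟩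
    rw [zpow_natCast, comm_origamiX_pow]
    have hn : cornerGen h ^ n = A⁻¹ * A' := hn
    rw [hn, mul_inv_cancel_left]

open Origami

theorem corner_origamiX_eq_iff {A A' : PGammaQuot} {h h' : Fin 4} :
    corner (sqX A h) = corner (sqX A' h') ↔
      h = h' ∧ A⁻¹ * A' ∈ Subgroup.zpowers (cornerGen h) :=
  corner_eq_iff.trans sameCycle_origamiX

/-- The corners with label h are the left cosets of the cyclic group generated by `cornerGen h` in a
group of order 12. -/
theorem ncard_cornersX (h : Fin 4) : (cornersX h).ncard = 12 / orderOf (cornerGen h) := by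
  let F : PGammaQuot ⧸ Subgroup.zpowers (cornerGen h) → origamiX.Surface :=
    @Quotient.lift _ _ (QuotientGroup.leftRel _) (fun A => corner (sqX A h)) fun A A' hA =>
      corner_origamiX_eq_iff.2 ⟨rfl, QuotientGroup.leftRel_apply.1 hA⟩
  have hF : Function.Injective F := by
    intro x y
    induction x using Quotient.inductionOn with | h A => ?_
    induction y using Quotient.inductionOn with | h A' => ?_
    exact fun hxy => QuotientGroup.eq.2 (corner_origamiX_eq_iff.1 hxy).2
  have hr : cornersX h = Set.range F := by
    ext x
    constructor
    · rintro ⟨A, rfl⟩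
      exact ⟨QuotientGroup.mk A, rfl⟩
    · rintro ⟨⟨A⟩, rfl⟩
      exact ⟨A, rfl⟩
  rw [hr, ← Nat.card_coe_set_eq, Nat.card_range_of_injective hF]
  have h1 := Subgroup.card_eq_card_quotient_mul_card_subgroup (Subgroup.zpowers (cornerGen h))
  rw [card_PGammaQuot, Nat.card_zpowers] at h1
  rw [h1, Nat.mul_div_cancel _ (orderOf_pos _)]

theorem ncard_cornersX_of_ne {h : Fin 4} (hh : h ≠ 2) : (cornersX h).ncard = 4 := by
  rw [ncard_cornersX, orderOf_cornerGen hh]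

theorem ncard_cornersX_two : (cornersX 2).ncard = 12 := by
  rw [ncard_cornersX, show cornerGen 2 = 1 from rfl, orderOf_one]

theorem disjoint_cornersX {h h' : Fin 4} (hh : h ≠ h') : Disjoint (cornersX h) (cornersX h') := by
  rw [Set.disjoint_left]
  rintro _ ⟨A, rfl⟩ ⟨A', hA⟩
  exact hh (corner_origamiX_eq_iff.1 hA).1.symm

theorem corner_origamiX_mem_singularities {A : PGammaQuot} {h : Fin 4} :
    corner (sqX A h) ∈ origamiX.singularities ↔ h ≠ 2 := by
  rw [mem_singularities_iff, isRegular_corner_iff, comm_origamiX]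
  constructor
  · rintro H rfl
    exact H (by rw [show cornerGen 2 = 1 from rfl, mul_one])
  · intro hh H
    exact cornerGen_ne_one hh (mul_eq_left.1 (sqX_inj.1 H).1)

theorem singularities_origamiX :
    origamiX.singularities = cornersX 0 ∪ cornersX 1 ∪ cornersX 3 := by
  ext x
  constructor
  · intro hx
    obtain ⟨s, -, rfl⟩ := mem_singularities_iff_exists.1 hx
    obtain ⟨A, h, rfl⟩ := exists_eq_sqX s
    have := corner_origamiX_mem_singularities.1 hx
    match h with
    | 0 => exact .inl (.inl ⟨A, rfl⟩)
    | 1 => exact .inl (.inr ⟨A, rfl⟩)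
    | 2 => exact absurd rfl this
    | 3 => exact .inr ⟨A, rfl⟩
  · rintro ((⟨A, rfl⟩ | ⟨A, rfl⟩) | ⟨A, rfl⟩) <;>
      exact corner_origamiX_mem_singularities.2 (by decide)

theorem finite_cornersX (h : Fin 4) : (cornersX h).Finite := Set.finite_range _

theorem ncard_singularities_origamiX : origamiX.singularities.ncard = 12 := by
  rw [singularities_origamiX, Set.ncard_union_eq _ ((finite_cornersX 0).union (finite_cornersX 1))
    (finite_cornersX 3), Set.ncard_union_eq (disjoint_cornersX (by decide)) (finite_cornersX 0)
    (finite_cornersX 1), ncard_cornersX_of_ne (by decide), ncard_cornersX_of_ne (by decide),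
    ncard_cornersX_of_ne (by decide)]
  rw [Set.disjoint_union_left]
  exact ⟨disjoint_cornersX (by decide), disjoint_cornersX (by decide)⟩

theorem vertices_origamiX :
    origamiX.vertices = origamiX.singularities ∪ cornersX 2 := by
  rw [vertices_eq, singularities_origamiX]
  ext x
  constructor
  · rintro ⟨s, rfl⟩
    obtain ⟨A, h, rfl⟩ := exists_eq_sqX s
    match h with
    | 0 => exact .inl (.inl (.inl ⟨A, rfl⟩))
    | 1 => exact .inl (.inl (.inr ⟨A, rfl⟩))
    | 2 => exact .inr ⟨A, rfl⟩
    | 3 => exact .inl (.inr ⟨A, rfl⟩)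
  · rintro (((⟨A, rfl⟩ | ⟨A, rfl⟩) | ⟨A, rfl⟩) | ⟨A, rfl⟩) <;> exact ⟨_, rfl⟩

theorem card_squares_origamiX : Nat.card origamiX.Sq = 48 := by
  change Nat.card (PGammaQuot × Fin 4) = 48
  rw [Nat.card_prod, card_PGammaQuot, Nat.card_fin]

theorem eulerChar_origamiX : origamiX.eulerChar = -24 := by
  rw [eulerChar_eq, card_squares_origamiX, vertices_origamiX,
    Set.ncard_union_eq _ finite_singularities (finite_cornersX 2), ncard_singularities_origamiX,
    ncard_cornersX_two]
  · norm_num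
  · rw [Set.disjoint_left]
    rintro _ h ⟨A, rfl⟩
    exact corner_origamiX_mem_singularities.1 h rfl

theorem coneAngle_of_mem_singularities {x : origamiX.Surface} (hx : x ∈ origamiX.singularities) :
    coneAngle x = 6 * Real.pi := by
  obtain ⟨s, -, rfl⟩ := mem_singularities_iff_exists.1 hx
  obtain ⟨A, h, rfl⟩ := exists_eq_sqX s
  have hh := corner_origamiX_mem_singularities.1 hx
  have hs : {s' : origamiX.Sq | origamiX.comm.SameCycle (sqX A h) s'} =
      (fun B => sqX (A * B) h) '' (Subgroup.zpowers (cornerGen h) : Set PGammaQuot) := by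
    ext s'
    obtain ⟨A', h', rfl⟩ := exists_eq_sqX s'
    refine sameCycle_origamiX.trans ⟨?_, ?_⟩
    · rintro ⟨rfl, H⟩
      exact ⟨_, H, by simp⟩
    · rintro ⟨B, hB, H⟩
      obtain ⟨rfl, rfl⟩ := sqX_inj.1 H
      exact ⟨rfl, by simpa using hB⟩
  rw [coneAngle_corner, hs, Set.ncard_image_of_injective _ fun B B' hB =>
    mul_left_cancel (sqX_inj.1 hB).1, ← Nat.card_coe_set_eq, SetLike.coe_sort_coe,
    Nat.card_zpowers, orderOf_cornerGen hh]
  push_cast; ring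

open Origami

/-! ### Connectedness of `X` -/

/-- Connectedness in combinatorial form: closed paths of labels through 0 realise right
multiplication by l⁻¹ and t⁻¹, which generate the group. Forward moves suffice because the
generators have order 3. -/
theorem square_induction {P : origamiX.Sq → Prop} (hr : ∀ s, P s → P (origamiX.right s))
    (hu : ∀ s, P s → P (origamiX.up s)) {s₀ : origamiX.Sq} (h₀ : P s₀) (s : origamiX.Sq) :
    P s := by
  obtain ⟨C, hC⟩ : ∃ C, P (sqX C 0) := by
    obtain ⟨C, h, rfl⟩ := exists_eq_sqX s₀
    match h with
    | 0 => exact ⟨C, h₀⟩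
    | 1 => exact ⟨_, hr _ h₀⟩
    | 2 => exact ⟨_, hu _ h₀⟩
    | 3 => exact ⟨_, hu _ (hr _ h₀)⟩
  have hLi : ∀ A, P (sqX A 0) → P (sqX (A * clL2⁻¹) 0) := fun A h => hr _ (hr _ h)
  have hL : ∀ A, P (sqX A 0) → P (sqX (A * clL2) 0) := fun A h => by
    have := hLi _ (hLi _ h)
    rwa [mul_assoc, ← _root_.mul_inv_rev, ← clL2_inv, inv_inv] at this
  have hTi : ∀ A, P (sqX A 0) → P (sqX (A * clT2⁻¹) 0) := fun A h => by
    -- Going up twice from label 0 multiplies by l t⁻¹; starting from A l⁻¹ cancels the factor l.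
    have : P (sqX (A * clL2⁻¹ * clL2 * clT2⁻¹) 0) := hu _ (hu _ (hLi A h))
    rwa [inv_mul_cancel_right] at this
  have hT : ∀ A, P (sqX A 0) → P (sqX (A * clT2) 0) := fun A h => by
    have := hTi _ (hTi _ h)
    rwa [mul_assoc, ← _root_.mul_inv_rev, ← clT2_inv, inv_inv] at this
  have h0 : ∀ A, P (sqX A 0) := fun A => by
    have key : ∀ D, P (sqX (C * D) 0) := fun D => by
      have hmem : D ∈ Subgroup.closure {clT2, clL2} := by
        rw [closure_clT2_clL2]; trivial
      induction hmem using Subgroup.closure_induction_right with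
      | one => rwa [mul_one]
      | mul_right x _ y hy ih =>
        rw [← mul_assoc]
        rcases hy with rfl | rfl
        · exact hT _ ih
        · exact hL _ ih
      | mul_inv_cancel x _ y hy ih =>
        rw [← mul_assoc]
        rcases hy with rfl | rfl
        · exact hTi _ ih
        · exact hLi _ ih
    rw [← mul_inv_cancel_left C A]; exact key _
  have h2 : ∀ A, P (sqX A 2) := fun A => by
    have : P (sqX (A * clL2⁻¹ * clL2) 2) := hu _ (h0 _)
    rwa [inv_mul_cancel_right] at this
  obtain ⟨A, h, rfl⟩ := exists_eq_sqX s
  match h with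
  | 0 => exact h0 A
  | 1 => exact hr _ (h0 A)
  | 2 => exact h2 A
  | 3 => exact hr _ (h2 A)

theorem connectedSpace_origamiX : ConnectedSpace origamiX.Surface := by
  have : Nonempty origamiX.Surface := ⟨corner (sqX 1 0)⟩
  have : PreconnectedSpace origamiX.Surface := by
    refine preconnectedSpace_of_forall_constant fun f hf => ?_
    have hs : ∀ s p q, f (pt s p) = f (pt s q) := fun s p q =>
      IsLocallyConstant.apply_eq_of_preconnectedSpace
        ((IsLocallyConstant.iff_continuous _).2 (hf.comp (continuous_pt s))) p q
    have key : ∀ s, f (corner s) = f (corner (sqX 1 0)) :=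
      square_induction (fun s h => by
        rw [← h, corner, zero_eq_vec, ← pt_right]; exact hs _ _ _) (fun s h => by
        rw [← h, corner, zero_eq_vec, ← pt_up]; exact hs _ _ _) rfl
    intro x y
    obtain ⟨⟨s, p⟩, rfl⟩ := pt_surjective x
    obtain ⟨⟨s', p'⟩, rfl⟩ := pt_surjective y
    exact (hs s p 0).trans ((key s).trans ((hs s' p' 0).trans (key s')).symm)
  exact ⟨inferInstance⟩

/-! ### Translations of `X` -/

theorem tau_map_pt (B A : PGammaQuot) (h : Fin 4) (p : Fin 2 → I) :
    (tau B).map (pt (sqX A h) p) = pt (sqX (B * A) h) p := rfl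

theorem tau_map_mul (B B' : PGammaQuot) (x : origamiX.Surface) :
    (tau (B * B')).map x = (tau B).map ((tau B').map x) := by
  obtain ⟨⟨s, p⟩, rfl⟩ := pt_surjective x
  obtain ⟨A, h, rfl⟩ := exists_eq_sqX s
  simp only [tau_map_pt, mul_assoc]

theorem tau_map_one (x : origamiX.Surface) : (tau 1).map x = x := by
  obtain ⟨⟨s, p⟩, rfl⟩ := pt_surjective x
  obtain ⟨A, h, rfl⟩ := exists_eq_sqX s
  simp only [tau_map_pt, one_mul]

/-- The homeomorphism `τ_B`. -/
def tauHomeo (B : PGammaQuot) : origamiX.Surface ≃ₜ origamiX.Surface :=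
  homeoOfInverse (g := (tau B⁻¹).map) (tau B).continuous_map
    (fun x => by rw [← tau_map_mul, inv_mul_cancel, tau_map_one])
    (fun x => by rw [← tau_map_mul, mul_inv_cancel, tau_map_one])

theorem tauHomeo_mem (B : PGammaQuot) : tauHomeo B ∈ origamiX.translationGroup :=
  IsStepAffine.isAffine (f := tauHomeo B) (A := 1) (tau B).isStepAffine_map

theorem Hom_map_eq {φ ψ : Hom origamiX origamiX} {s₀ : origamiX.Sq}
    (h : φ.toFun s₀ = ψ.toFun s₀) (x : origamiX.Surface) : φ.map x = ψ.map x := by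
  have key : ∀ s, φ.toFun s = ψ.toFun s :=
    square_induction (fun s h => by rw [φ.map_right, ψ.map_right, h])
      (fun s h => by rw [φ.map_up, ψ.map_up, h]) h
  obtain ⟨⟨s, p⟩, rfl⟩ := pt_surjective x
  simp only [Hom.map_pt, key]

theorem exists_eq_tau {φ : Hom origamiX origamiX} {A A' : PGammaQuot} {h : Fin 4}
    (hφ : φ.toFun (sqX A h) = sqX A' h) : ∃ B, ∀ x, φ.map x = (tau B).map x :=
  ⟨A' * A⁻¹, Hom_map_eq (s₀ := sqX A h) <| hφ.trans <| by
    change sqX A' h = sqX (A' * A⁻¹ * A) h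
    rw [inv_mul_cancel_right]⟩

/-- Each square of `X` has a corner which is a singularity. -/
theorem exists_singular_corner (s : origamiX.Sq) : ∃ p, pt s p ∈ origamiX.singularities := by
  obtain ⟨A, h, rfl⟩ := exists_eq_sqX s
  by_cases hh : h = 2
  · subst hh
    -- The lower left corner is regular for this label, but the lower right corner is the lower left
    -- corner of the square (A, 3) in the numbering from 0.
    refine ⟨![1, 0], ?_⟩
    rw [pt_right, ← zero_eq_vec]
    exact corner_origamiX_mem_singularities (A := A) (h := 3) |>.2 (by decide)
  · exact ⟨0, corner_origamiX_mem_singularities.2 hh⟩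

/-- The displacement in the torus is constant on each square, and it vanishes at a singular corner,
since that corner and its image both lie over 0. -/
theorem Origami.IsAffine.toTorus_apply_of_one {f : origamiX.Surface ≃ₜ origamiX.Surface}
    (hf : IsAffine f 1) (x : origamiX.Surface) : toTorus (f x) = toTorus x := by
  obtain ⟨⟨s, p⟩, rfl⟩ := pt_surjective x
  obtain ⟨q, hq⟩ := exists_singular_corner s
  rw [hf.toTorus_eq s q p, toTorus_eq_zero_of_mem_singularities ((hf.1 _).2 hq),
    (step_pt s q p).toTorus_eq, toTorus_eq_zero_of_mem_singularities hq]
  simp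

/-- Among the labels, `2` is the only one whose lower left corners are regular, so a translation
preserves it. Two squares with equal labels differ by some τ_B, and one square determines the map.
-/
theorem exists_tauHomeo_eq_of_mem {f : origamiX.Surface ≃ₜ origamiX.Surface}
    (hf : f ∈ origamiX.translationGroup) : ∃ B, tauHomeo B = f := by
  have hf : IsAffine f 1 := hf
  obtain ⟨φ, hφ⟩ := exists_hom_of_toTorus_eq f.continuous hf.toTorus_apply_of_one
  obtain ⟨A', h, hA'⟩ := exists_eq_sqX (φ.toFun (sqX 1 2))
  have hh : h = 2 := by
    by_contra hh
    have h1 := corner_origamiX_mem_singularities (A := A').2 hh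
    rw [← hA', corner, ← φ.map_pt, ← hφ, hf.1] at h1
    exact corner_origamiX_mem_singularities.1 h1 rfl
  subst hh
  obtain ⟨B, hB⟩ := exists_eq_tau hA'
  exact ⟨B, Homeomorph.ext fun x => ((hφ x).trans (hB x)).symm⟩

theorem tauHomeo_injective : Function.Injective tauHomeo := by
  intro B B' h
  obtain ⟨m, hm, -⟩ := exists_interior_of_eventually (p := 0) (P := fun _ => True) (by simp)
  have h1 : pt (sqX (B * 1) 0) m = pt (sqX (B' * 1) 0) m :=
    congrArg (fun f : origamiX.Surface ≃ₜ origamiX.Surface => f (pt (sqX 1 0) m)) h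
  simpa [sqX_inj] using (pt_eq_iff_of_mem_interior hm hm).1 h1

/-- The homomorphism `B ↦ τ_B`. -/
def tauHom : PGammaQuot →* origamiX.translationGroup where
  toFun := fun B => ⟨tauHomeo B, tauHomeo_mem B⟩
  map_one' := Subtype.ext (Homeomorph.ext tau_map_one)
  map_mul' := fun B B' => Subtype.ext (Homeomorph.ext (tau_map_mul B B'))

/-- The isomorphism `B ↦ τ_B`. -/
def tauEquiv : PGammaQuot ≃* origamiX.translationGroup :=
  MulEquiv.ofBijective tauHom
    ⟨fun _ _ h => tauHomeo_injective (Subtype.ext_iff.1 h), fun ⟨_, hf⟩ =>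
      let ⟨B, hB⟩ := exists_tauHomeo_eq_of_mem hf
      ⟨B, Subtype.ext hB⟩⟩

/-! ### The covering `X → E[2]` -/

theorem comm_origamiE2 : origamiE2.comm = 1 := by
  change rightE2 * upE2 * rightE2⁻¹ * upE2⁻¹ = 1
  decide

/-- The square of `E[2]` with label `h`. -/
def sqE2 (h : Fin 4) : origamiE2.Sq := h

theorem sqE2_inj {h h' : Fin 4} : sqE2 h = sqE2 h' ↔ h = h' := Iff.rfl

theorem coveringP_map_pt (A : PGammaQuot) (h : Fin 4) (p : Fin 2 → I) :
    coveringP.map (pt (sqX A h) p) = pt (sqE2 h) p := rfl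

theorem coveringP_map_tau (B : PGammaQuot) (x : origamiX.Surface) :
    coveringP.map ((tau B).map x) = coveringP.map x := by
  obtain ⟨⟨s, p⟩, rfl⟩ := pt_surjective x
  rfl

/-- The commutator of E[2] is trivial, so points of E[2] have unique normal forms. Points in one
fibre thus have the same label and coordinates, and left multiplication by A' A⁻¹ carries one to the
other. -/
theorem exists_tau_eq {x y : origamiX.Surface} (h : coveringP.map x = coveringP.map y) :
    ∃ B, (tau B).map x = y := by
  obtain ⟨s, p, hp, rfl⟩ := exists_eq_pt x
  obtain ⟨s', p', hp', rfl⟩ := exists_eq_pt y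
  obtain ⟨A, k, rfl⟩ := exists_eq_sqX s
  obtain ⟨A', k', rfl⟩ := exists_eq_sqX s'
  rw [coveringP_map_pt, coveringP_map_pt, pt_eq_iff_of_ne hp hp', comm_origamiE2,
    Equiv.Perm.sameCycle_one, sqE2_inj] at h
  obtain ⟨rfl, h⟩ := h
  obtain rfl : k = k' := h.elim id And.right
  exact ⟨A' * A⁻¹, by rw [tau_map_pt, inv_mul_cancel_right]⟩

theorem coveringP_surjective : Function.Surjective coveringP.map := by
  intro y
  obtain ⟨⟨h, p⟩, rfl⟩ := pt_surjective y
  exact ⟨pt (sqX 1 h) p, rfl⟩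

/-- Two different maps τ can agree only at a corner whose `cornerGen` is nontrivial, and these
corners lie over P, Q and S. -/
theorem eq_of_tau_map_eq {B B' : PGammaQuot} {x : origamiX.Surface}
    (hx : coveringP.map x ∉ pointsPQS) (h : (tau B).map x = (tau B').map x) : B = B' := by
  obtain ⟨s, p, hp, rfl⟩ := exists_eq_pt x
  obtain ⟨A, k, rfl⟩ := exists_eq_sqX s
  rw [tau_map_pt, tau_map_pt, pt_eq_iff_of_ne hp hp, sqX_inj, sameCycle_origamiX] at h
  rcases h.2 with h | ⟨rfl, -, h⟩
  · exact mul_right_cancel h.1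
  · have hk : k = 2 := by
      by_contra hk
      have : ∀ k : Fin 4, k ≠ 2 → k = 0 ∨ k = 1 ∨ k = 3 := by decide
      exact hx ⟨k, this k hk, rfl⟩
    subst hk
    rw [show cornerGen 2 = 1 from rfl, Subgroup.zpowers_one_eq_bot, Subgroup.mem_bot,
      inv_mul_eq_one] at h
    exact mul_right_cancel h

theorem ncard_fiber_coveringP {y : origamiE2.Surface} (hy : y ∉ pointsPQS) :
    (coveringP.map ⁻¹' {y}).ncard = 12 := by
  obtain ⟨x, rfl⟩ := coveringP_surjective y
  have : coveringP.map ⁻¹' {coveringP.map x} = Set.range fun B => (tau B).map x := by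
    ext z
    constructor
    · intro hz
      exact exists_tau_eq (Eq.symm hz)
    · rintro ⟨B, rfl⟩
      exact coveringP_map_tau B x
  rw [this, ← Nat.card_coe_set_eq, Nat.card_range_of_injective fun B B' h => eq_of_tau_map_eq hy h,
    card_PGammaQuot]

theorem isQuotientMap_coveringP : IsQuotientMap coveringP.map :=
  coveringP.continuous_map.isClosedMap.isQuotientMap coveringP.continuous_map coveringP_surjective

/-- The action of `PΓ₂ / PΓ₆` on `X` by the maps `τ_B`. -/
@[reducible] def tauAction : MulAction PGammaQuot origamiX.Surface where
  smul B x := (tau B).map x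
  one_smul := tau_map_one
  mul_smul := tau_map_mul

/-- p is the quotient map for an action of a finite group on a compact Hausdorff space, hence a
covering over the points where stabilisers are trivial. -/
theorem isCoveringMapOn_coveringP : IsCoveringMapOn coveringP.map pointsPQSᶜ := by
  let _ := tauAction
  have : ContinuousConstSMul PGammaQuot origamiX.Surface := ⟨fun B => (tau B).continuous_map⟩
  refine (isQuotientMap_coveringP.isCoveringMapOn_of_properlyDiscontinuousSMul
    (G := PGammaQuot) fun {x y} => ⟨fun h => exists_tau_eq h.symm, ?_⟩).mono ?_
  · rintro ⟨B, rfl⟩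
    exact coveringP_map_tau B y
  · intro y hy
    obtain ⟨x, rfl⟩ := coveringP_surjective y
    refine ⟨x, ?_, rfl⟩
    rw [Set.mem_ofPred_eq, Subgroup.eq_bot_iff_forall]
    intro B hB
    exact eq_of_tau_map_eq hy (hB.trans (tau_map_one x).symm)

/-- The torus projection of X factors through p, so deck transformations commute with it and are
induced by maps of squares. Labels are preserved, which leaves only the τ_B. -/
theorem deckGroup_coveringP : deckGroup coveringP.map = origamiX.translationGroup := by
  ext f
  constructor
  · intro hf
    have hf : ∀ x, coveringP.map (f x) = coveringP.map x := hf
    have htorus : ∀ x, toTorus (f x) = toTorus x := fun x => by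
      rw [← coveringP.toTorus_map, hf, coveringP.toTorus_map]
    obtain ⟨φ, hφ⟩ := exists_hom_of_toTorus_eq f.continuous htorus
    obtain ⟨A', h, hA'⟩ := exists_eq_sqX (φ.toFun (sqX 1 0))
    obtain ⟨m, hm, -⟩ := exists_interior_of_eventually (p := 0) (P := fun _ => True) (by simp)
    have h1 := hf (pt (sqX 1 0) m)
    rw [hφ, Hom.map_pt, hA', coveringP_map_pt, coveringP_map_pt,
      pt_eq_iff_of_mem_interior hm hm] at h1
    obtain rfl := h1.2
    obtain ⟨B, hB⟩ := exists_eq_tau hA'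
    have : f = tauHomeo B := Homeomorph.ext fun x => (hφ x).trans (hB x)
    rw [this]
    exact tauHomeo_mem B
  · intro hf
    obtain ⟨B, rfl⟩ := exists_tauHomeo_eq_of_mem hf
    exact coveringP_map_tau B

theorem exists_deck_eq {x y : origamiX.Surface} (h : coveringP.map x = coveringP.map y) :
    ∃ f ∈ deckGroup coveringP.map, f x = y := by
  obtain ⟨B, hB⟩ := exists_tau_eq h
  exact ⟨tauHomeo B, coveringP_map_tau B, hB⟩

theorem exists_modTranslations_homeo : ∃ Φ : origamiX.ModTranslations ≃ₜ origamiE2.Surface,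
    ∀ x : origamiX.Surface, Φ (Quotient.mk _ x) = coveringP.map x := by
  let F : origamiX.ModTranslations → origamiE2.Surface :=
    Quotient.lift coveringP.map fun x y ⟨f, hf, hxy⟩ => by
      rw [← deckGroup_coveringP] at hf
      rw [← hxy]; exact (hf x).symm
  have hF : Function.Bijective F := by
    constructor
    · intro x y
      induction x using Quotient.inductionOn with | h x => ?_
      induction y using Quotient.inductionOn with | h y => ?_
      intro h
      obtain ⟨f, hf, hxy⟩ := exists_deck_eq (x := x) (y := y) h
      exact Quotient.sound ⟨f, deckGroup_coveringP ▸ hf, hxy⟩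
    · intro y
      obtain ⟨x, rfl⟩ := coveringP_surjective y
      exact ⟨Quotient.mk _ x, rfl⟩
  exact ⟨Continuous.homeoOfEquivCompactToT2 (f := Equiv.ofBijective F hF)
    (coveringP.continuous_map.quotient_lift _), fun _ => rfl⟩

/-! ### The Veech group of `X` -/

/-- The permutation of the squares of `X` induced by the quarter turn. -/
def turnSquares : Equiv.Perm (PGammaQuot × Fin 4) where
  toFun
    | (A, 0) => (A * clT2⁻¹, 2)
    | (A, 1) => (A * clT2, 0)
    | (A, 2) => (A * clT2, 3)
    | (A, 3) => (A * clT2⁻¹, 1)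
  invFun
    | (A, 0) => (A * clT2⁻¹, 1)
    | (A, 1) => (A * clT2, 3)
    | (A, 2) => (A * clT2, 0)
    | (A, 3) => (A * clT2⁻¹, 2)
  left_inv := by
    rintro ⟨A, h⟩
    fin_cases h <;> simp
  right_inv := by
    rintro ⟨A, h⟩
    fin_cases h <;> simp

/-- The permutation of the squares of `X` induced by the shear. -/
def shearSquares : Equiv.Perm (PGammaQuot × Fin 4) where
  toFun
    | (A, 0) => (A * clL2⁻¹, 1)
    | (A, 1) => (A * clL2, 0)
    | (A, 2) => (A * clL2, 2)
    | (A, 3) => (A * clL2, 3)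
  invFun
    | (A, 0) => (A * clL2⁻¹, 1)
    | (A, 1) => (A * clL2, 0)
    | (A, 2) => (A * clL2⁻¹, 2)
    | (A, 3) => (A * clL2⁻¹, 3)
  left_inv := by
    rintro ⟨A, h⟩
    fin_cases h <;> simp
  right_inv := by
    rintro ⟨A, h⟩
    fin_cases h <;> simp

/-- A quarter turn sends right edges to upper edges. In terms of t and l the four cases need only t³
= 1 and (tl)² = 1. -/
theorem turnSquares_right (s : PGammaQuot × Fin 4) :
    turnSquares (rightX s) = upX (turnSquares s) := by
  obtain ⟨A, h⟩ := s
  match h with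
  | 0 =>
    change (A * clT2, (0 : Fin 4)) = (A * clT2⁻¹ * clT2⁻¹, 0)
    rw [mul_assoc, ← _root_.mul_inv_rev, ← clT2_inv, inv_inv]
  | 1 =>
    change (A * clL2⁻¹ * clT2⁻¹, (2 : Fin 4)) = (A * clT2 * clL2, 2)
    rw [mul_assoc, mul_assoc, clT2_mul_clL2]
  | 2 =>
    change (A * clT2⁻¹, (1 : Fin 4)) = (A * clT2 * clT2, 1)
    rw [mul_assoc, ← clT2_inv]
  | 3 =>
    change (A * clL2 * clT2, (3 : Fin 4)) = (A * clT2⁻¹ * clL2⁻¹, 3)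
    rw [mul_assoc, mul_assoc, clL2_mul_clT2]

theorem right_turnSquares_up (s : PGammaQuot × Fin 4) :
    rightX (turnSquares (upX s)) = turnSquares s := by
  obtain ⟨A, h⟩ := s
  match h with
  | 0 =>
    change (A * clL2 * clT2 * clL2, (2 : Fin 4)) = (A * clT2⁻¹, 2)
    rw [mul_assoc (A * clL2), clT2_mul_clL2, ← mul_assoc, mul_inv_cancel_right]
  | 1 =>
    change (A * clL2⁻¹ * clT2⁻¹ * clL2⁻¹, (0 : Fin 4)) = (A * clT2, 0)
    rw [mul_assoc (A * clL2⁻¹), ← clL2_mul_clT2, ← mul_assoc, inv_mul_cancel_right]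
  | 2 =>
    change (A * clT2⁻¹ * clT2⁻¹, (3 : Fin 4)) = (A * clT2, 3)
    rw [mul_assoc, ← _root_.mul_inv_rev, ← clT2_inv, inv_inv]
  | 3 =>
    change (A * clT2 * clT2, (1 : Fin 4)) = (A * clT2⁻¹, 1)
    rw [mul_assoc, ← clT2_inv]

theorem shearSquares_right (s : PGammaQuot × Fin 4) :
    shearSquares (rightX s) = rightX (shearSquares s) := by
  obtain ⟨A, h⟩ := s
  match h with
  | 0 =>
    change (A * clL2, (0 : Fin 4)) = (A * clL2⁻¹ * clL2⁻¹, 0)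
    rw [mul_assoc, ← _root_.mul_inv_rev, ← clL2_inv, inv_inv]
  | 1 =>
    change (A * clL2⁻¹ * clL2⁻¹, (1 : Fin 4)) = (A * clL2, 1)
    rw [mul_assoc, ← _root_.mul_inv_rev, ← clL2_inv, inv_inv]
  | 2 => rfl
  | 3 => rfl

/-- The upper edge of a square is sheared to the upper edge of the square to the right of its image,
which explains the extra `rightX`. -/
theorem shearSquares_up (s : PGammaQuot × Fin 4) :
    shearSquares (upX s) = upX (rightX (shearSquares s)) := by
  obtain ⟨A, h⟩ := s
  match h with
  | 0 =>
    change (A * clL2 * clL2, (2 : Fin 4)) = (A * clL2⁻¹ * clL2⁻¹ * clL2, 2)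
    rw [inv_mul_cancel_right, mul_assoc, ← clL2_inv]
  | 1 =>
    change (A * clL2⁻¹ * clL2, (3 : Fin 4)) = (A * clL2 * clL2⁻¹, 3)
    rw [inv_mul_cancel_right, mul_inv_cancel_right]
  | 2 =>
    change (A * clT2⁻¹ * clL2⁻¹, (1 : Fin 4)) = (A * clL2 * clT2, 1)
    rw [mul_assoc, mul_assoc, clL2_mul_clT2]
  | 3 =>
    change (A * clT2 * clL2, (0 : Fin 4)) = (A * clL2 * clL2 * clT2⁻¹, 0)
    rw [mul_assoc A clL2, ← clL2_inv, mul_assoc, mul_assoc, clT2_mul_clL2]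

theorem range_le_veechGroup :
    (Matrix.SpecialLinearGroup.map (n := Fin 2) (Int.castRingHom ℝ)).range ≤
      origamiX.veechGroup := by
  have hmem : ∀ {f : origamiX.Surface ≃ₜ origamiX.Surface} {A : SL(2, ℝ)},
      IsStepAffine f A.1 → A ∈ origamiX.veechGroup := fun {f A} h =>
    ⟨f, ⟨A, h.isAffine⟩, h.isAffine⟩
  rw [MonoidHom.range_eq_map, ← SpecialLinearGroup.SL2Z_generators, 
    Subgroup.map_le_iff_le_comap, Subgroup.closure_le]
  rintro _ (rfl | rfl)
  · obtain ⟨f, hf⟩ := exists_affine_rotation (O := origamiX) turnSquares_right right_turnSquares_up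
    refine hmem (f := f) ?_
    convert hf
    ext i j
    rw [Matrix.SpecialLinearGroup.map_apply_coe, ModularGroup.coe_S]
    fin_cases i <;> fin_cases j <;> simp
  · obtain ⟨f, hf⟩ := exists_affine_shear (O := origamiX) shearSquares_right shearSquares_up
    refine hmem (f := f) ?_
    convert hf
    ext i j
    rw [Matrix.SpecialLinearGroup.map_apply_coe, ModularGroup.coe_T]
    fin_cases i <;> fin_cases j <;> simp

theorem veechGroup_le_range : origamiX.veechGroup ≤
    (Matrix.SpecialLinearGroup.map (n := Fin 2) (Int.castRingHom ℝ)).range := by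
  rintro A ⟨f, -, hf⟩
  have hint : ∀ p q, pt (sqX 1 0) p ∈ origamiX.singularities →
      pt (sqX 1 0) q ∈ origamiX.singularities → ∀ i,
      ∃ n : ℤ, (n : ℝ) = (A.1 *ᵥ (toPlane q - toPlane p)) i := fun p q hp hq i => by
    have h := congrFun (hf.toTorus_eq (sqX 1 0) p q) i
    rw [toTorus_eq_zero_of_mem_singularities ((hf.1 _).2 hp),
      toTorus_eq_zero_of_mem_singularities ((hf.1 _).2 hq), zero_add] at h
    obtain ⟨n, hn⟩ := (AddCircle.coe_eq_zero_iff 1).1 h.symm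
    exact ⟨n, by simpa using hn⟩
  have h00 : pt (sqX 1 0) 0 ∈ origamiX.singularities :=
    corner_origamiX_mem_singularities.2 (by decide)
  have h10 : pt (sqX 1 0) ![1, 0] ∈ origamiX.singularities := by
    rw [pt_right, ← zero_eq_vec]
    exact corner_origamiX_mem_singularities (A := 1) (h := 1) |>.2 (by decide)
  -- The upper left corner of this square is regular, so the second basis vector is read off along
  -- the right edge, from (1, 0) to (1, 1).
  have h11 : pt (sqX 1 0) ![1, 1] ∈ origamiX.singularities := by
    rw [pt_right, pt_up, ← zero_eq_vec]
    exact corner_origamiX_mem_singularities (A := 1 * clL2⁻¹) (h := 3) |>.2 (by decide)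
  choose a ha using hint _ _ h00 h10
  choose b hb using hint _ _ h10 h11
  have ha : ∀ i, A.1 i 0 = a i := fun i => by
    rw [ha]; simp [toPlane, mulVec, dotProduct, Fin.sum_univ_two]
  have hb : ∀ i, A.1 i 1 = b i := fun i => by
    rw [hb]; simp [toPlane, mulVec, dotProduct, Fin.sum_univ_two]
  have hdet := A.det_coe
  rw [det_fin_two, ha, ha, hb, hb] at hdet
  refine ⟨⟨!![a 0, b 0; a 1, b 1], ?_⟩, ?_⟩
  · rw [det_fin_two_of]; exact_mod_cast hdet
  · ext i j
    fin_cases j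
    · rw [show ((A : Matrix (Fin 2) (Fin 2) ℝ) i ((fun k => k) ⟨0, by decide⟩)) = a i from ha i]
      fin_cases i <;> rfl
    · rw [show ((A : Matrix (Fin 2) (Fin 2) ℝ) i ((fun k => k) ⟨1, by decide⟩)) = b i from hb i]
      fin_cases i <;> rfl
end

theorem mainTheorem7 :
    -- `X` is a closed connected surface tiled by 48 squares, and has genus 13
    Nat.card origamiX.Sq = 48 ∧
    CompactSpace origamiX.Surface ∧ T2Space origamiX.Surface ∧
    origamiX.HasGenus 13 ∧
    -- the twelve singularities are the four `P_i`, the four `Q_i` and the four `S_i`; their cone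
    -- angle is `6π`, and all other points have cone angle `2π`
    origamiX.singularities.ncard = 12 ∧
    origamiX.singularities = cornersX 0 ∪ cornersX 1 ∪ cornersX 3 ∧
    (cornersX 0).ncard = 4 ∧ (cornersX 1).ncard = 4 ∧ (cornersX 3).ncard = 4 ∧
    (∀ x ∈ origamiX.singularities, Origami.coneAngle x = 6 * Real.pi) ∧
    (∀ x ∉ origamiX.singularities, Origami.coneAngle x = 2 * Real.pi) ∧
    -- `Trans(X) = {τ_B}`, and `B ↦ τ_B` is an isomorphism from `PΓ₂ / PΓ₆ ≅ PSL₂(ℤ/3)`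
    (∃ e : PGammaQuot ≃* origamiX.translationGroup,
      ∀ (B : PGammaQuot) (x : origamiX.Surface),
        (e B : origamiX.Surface ≃ₜ origamiX.Surface) x = (tau B).map x) ∧
    Nonempty (PGammaQuot ≃* PSL(2, ZMod 3)) ∧
    -- `X / Trans(X) ≅ E[2]`, by the map induced by `p`, which is a local translation
    (∃ Φ : origamiX.ModTranslations ≃ₜ origamiE2.Surface,
      ∀ x : origamiX.Surface, Φ (Quotient.mk _ x) = coveringP.map x) ∧
    Origami.IsLocalTranslation coveringP.map ∧
    -- `p : X → E[2]` is a covering outside of the points `P`, `Q`, `S` of `E[2]`, of degree 12,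
    -- and it is normal with group of deck transformations `Trans(X) ≅ PΓ₂ / PΓ₆`
    IsCoveringMapOn coveringP.map pointsPQSᶜ ∧
    (∀ y ∉ pointsPQS, (coveringP.map ⁻¹' {y}).ncard = 12) ∧
    deckGroup coveringP.map = origamiX.translationGroup ∧
    (∀ x y : origamiX.Surface, coveringP.map x = coveringP.map y →
      ∃ f ∈ deckGroup coveringP.map, f x = y) ∧
    -- the Veech group is `SL₂(ℤ)`
    origamiX.veechGroup =
      (Matrix.SpecialLinearGroup.map (n := Fin 2) (Int.castRingHom ℝ)).range := by
  refine ⟨card_squares_origamiX, inferInstance, inferInstance,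
    ⟨connectedSpace_origamiX, by rw [eulerChar_origamiX]; norm_num⟩,
    ncard_singularities_origamiX, singularities_origamiX, ncard_cornersX_of_ne (by decide),
    ncard_cornersX_of_ne (by decide), ncard_cornersX_of_ne (by decide),
    fun x hx => coneAngle_of_mem_singularities hx,
    fun x hx => Origami.coneAngle_of_isRegular (not_not.1 fun h => hx (Origami.mem_singularities_iff.2 h)),
    ⟨tauEquiv, fun _ _ => rfl⟩, ⟨quotEquiv⟩, exists_modTranslations_homeo,
    coveringP.isStepAffine_map.isLocalTranslation, isCoveringMapOn_coveringP,
    fun y hy => ncard_fiber_coveringP hy, deckGroup_coveringP, fun x y h => exists_deck_eq h,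
    le_antisymm veechGroup_le_range range_le_veechGroup⟩
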